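/- Let $H$ be a separable infinite-dimensional complex Hilbert space. A symmetric norming (s.n.) function is a norm $\Phi$ on the space of finitely supported real sequences with $\Phi(1,0,0,\dots)=1$ that is invariant under permutations and under taking absolute values. For a bounded operator $x$ on a Hilbert space let $s_k(x)$ $(k\ge 1)$ be its singular numbers, i.e. the distance of $x$ to the operators of rank $<k$ (for compact $x$: the nonincreasing list of the eigenvalues of $|x|$), and put $\|x\|_\Phi=\lim_n\Phi(s_1(x),\dots,s_n(x),0,\dots)\in[0,\infty]$. Let $\mathfrak S_\Phi$ be the ideal of compact operators with $\|x\|_\Phi<\infty$. Let $\Phi^*(\eta)=\max_\xi\frac1{\Phi(\xi)}\sum_i\eta_i^*\xi_i$ be the adjoint of $\Phi$, where $\eta^*$ is the nonincreasing rearrangement of $|\eta|$ and $\xi$ runs over the nonzero nonincreasing nonnegative finitely supported sequences, and let $\tilde\Phi(a)=\Phi(a_1^2,a_2^2,\dots)^{1/2}$. For $T=\sum_i\xi_i\otimes T_i\in H\otimes M_n=M_n(H)$, with $(\xi_i)$ orthonormal, let $\rho_T(y)=\sum_iT_iyT_i^*$ for $y\in M_n$. The spaces $R$, $C$ and $H(\Phi,\Psi)$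 (for s.n. functions $\Phi\ge\Psi$) are $H$ with the matrix norms $$\|T\|_R=\Big\|\sum_i T_iT_i^*\Big\|^{1/2},\qquad \|T\|_C=\Big\|\sum_i T_i^*T_i\Big\|^{1/2},\qquad \|T\|_{\Phi,\Psi}=\Big(\sup_{0\ne y\in M_n}\frac{\|\rho_T(y)\|_\Psi}{\|y\|_\Phi}\Big)^{1/2}.$$ $CB(E,F)$ denotes the space of linear maps $u:H\to H$ with $\|u\|_{CB(E,F)}=\sup_n\|\mathrm{id}_n\otimes u:M_n(E)\to M_n(F)\|<\infty$. The space $H(\Phi,\Psi)$ is called an operator space if its matrix norms satisfy Ruan's axioms (M1) $\|x\oplus y\|_{m+n}=\max(\|x\|_m,\|y\|_n)$ and (M2) $\|axb\|_n\le\|a\|\,\|x\|_m\|b\|$ for scalar matrices $a,b$. **Theorem.** Let $\Phi\ge\Psi$ be s.n. functions. (a) For every $x\in B(H)$, with both sides in $[0,\infty]$, $$\|x\|_{CB(R,H(\Phi,\Psi))}=\Big(\sup_{0\ne a\in\mathfrak S_\Phi}\frac{\big\||x|^2\otimes a\big\|_\Psi}{\|a\|_\Phi}\Big)^{1/2}.$$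 (b) If $H(\Phi,\Psi)$ is an operator space, then isometrically $$CB(R,H(\Phi,\Psi))=\mathfrak S_{\tilde\Psi},\qquad CB(C,H(\Phi,\Psi))=\mathfrak S_{\widetilde{\Phi^*}}.$$ Here an s.n. function $\Theta$ (namely $\Theta=\tilde\Psi$, resp. $\Theta=\widetilde{\Phi^*}$) that is equivalent to the sup norm is an exceptional case: then $\mathfrak S_\Theta$ has to be read as the space of all bounded $x$ with $\|x\|_\Theta<\infty$, that is, as $B(H)$ with the norm $\|\cdot\|_\Theta$. (c) With the same reading, the first identification in (b) already holds if $$\frac{\|x\otimes y\|_\Psi}{\|x\|_\Psi}\le\frac{\|z\otimes y\|_\Phi}{\|z\|_\Phi}\qquad\text{for all }x,y,z\in\mathfrak S_\Phi,\ x,z\neq0,$$ and the second already holds if this inequality is satisfied with $(\Psi^*,\Phi^*)$ in place of $(\Phi,\Psi)$. -/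

import Mathlib

open scoped ENNReal TensorProduct

noncomputable section

namespace NormedIdeals

/-! ### Symmetric norming functions on finitely supported real sequences -/

/-- `Φ` is a symmetric norming function: a norm on the space of finitely supported real
sequences, normalised by `Φ (1, 0, 0, …) = 1`, and invariant under permutations and absolute
values. -/
structure IsSNFunction (Φ : (ℕ →₀ ℝ) → ℝ) : Prop where
  add_le : ∀ ξ η, Φ (ξ + η) ≤ Φ ξ + Φ η
  smul : ∀ (c : ℝ) ξ, Φ (c • ξ) = |c| * Φ ξ
  eq_zero : ∀ ξ, Φ ξ = 0 → ξ = 0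
  normalized : Φ (Finsupp.single 0 1) = 1
  symm : ∀ (σ : Equiv.Perm ℕ) ξ,
    Φ ((ξ.mapRange (fun t : ℝ => |t|) abs_zero).equivMapDomain σ) = Φ ξ

/-- The nonincreasing rearrangement `η*` of `|η|` (indexed from `0`):
`η* i` is the least `t ≥ 0` such that at most `i` entries of `|η|` exceed `t`. -/
def decrRearr (η : ℕ →₀ ℝ) (i : ℕ) : ℝ :=
  sInf {t : ℝ | 0 ≤ t ∧ (η.support.filter (fun j => t < |η j|)).card ≤ i}

/-- The adjoint `Φ*`: `Φ*(η) = max_ξ (∑ i, η*_i ξ_i) / Φ(ξ)`, the maximum being over the nonzero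
nonincreasing nonnegative finitely supported sequences `ξ`. -/
def adjointFn (Φ : (ℕ →₀ ℝ) → ℝ) (η : ℕ →₀ ℝ) : ℝ :=
  sSup {r : ℝ | ∃ ξ : ℕ →₀ ℝ, ξ ≠ 0 ∧ (∀ i, 0 ≤ ξ i) ∧ Antitone (fun i => ξ i) ∧
    r = (ξ.sum fun i c => decrRearr η i * c) / Φ ξ}

/-- The 2-convexification `Φ~ (a) = Φ (a²) ^ (1/2)`. -/
def twoConvex (Φ : (ℕ →₀ ℝ) → ℝ) (ξ : ℕ →₀ ℝ) : ℝ :=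
  Real.sqrt (Φ (ξ.mapRange (fun t : ℝ => t ^ 2) (zero_pow two_ne_zero)))

/-- `Φ` is dominated by a multiple of the sup norm. (A symmetric norming function always dominates
the sup norm, so this says that it is equivalent to it.) -/
def SupEquivalent (Φ : (ℕ →₀ ℝ) → ℝ) : Prop :=
  ∃ C : ℝ, ∀ ξ : ℕ →₀ ℝ, Φ ξ ≤ C * ⨆ i, |ξ i|

/-- The truncation `(s₀, …, s_{n-1}, 0, 0, …)`. -/
def trunc (s : ℕ → ℝ) (n : ℕ) : ℕ →₀ ℝ :=
  Finsupp.onFinset (Finset.range n) (fun i => if i < n then s i else 0)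
    (fun i hi => by
      by_contra h
      exact hi (if_neg (fun h' => h (Finset.mem_range.2 h'))))

/-! ### Singular numbers and the ideals `𝔖_Φ` -/

section Operators

variable {E : Type*} [NormedAddCommGroup E] [InnerProductSpace ℂ E]

/-- The singular numbers of a bounded operator on a Hilbert space, indexed from `0`: `s_k(x)` is the
distance from `x` to the operators of rank at most `k`. For compact `x` this is the `k`-th
term of the nonincreasing list of eigenvalues of `|x|`. -/
def sNumber (x : E →L[ℂ] E) (k : ℕ) : ℝ :=
  sInf {r : ℝ | ∃ F : E →L[ℂ] E, LinearMap.rank (F : E →ₗ[ℂ] E) ≤ (k : Cardinal) ∧ r = ‖x - F‖}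

/-- `‖x‖_Φ = lim_n Φ(s₀(x), …, s_{n-1}(x), 0, 0, …) ∈ [0, ∞]`; the sequence is nondecreasing, so
that the limit is the supremum. -/
def idealNorm (Φ : (ℕ →₀ ℝ) → ℝ) (x : E →L[ℂ] E) : ℝ≥0∞ :=
  ⨆ n : ℕ, ENNReal.ofReal (Φ (trunc (sNumber x) n))

/-- The symmetrically normed ideal `𝔖_Φ` of compact operators with `‖x‖_Φ < ∞`. -/
def symmIdeal (Φ : (ℕ →₀ ℝ) → ℝ) : Set (E →L[ℂ] E) :=
  {x | IsCompactOperator x ∧ idealNorm Φ x < ∞}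

/-- All bounded operators with `‖x‖_Φ < ∞`. -/
def boundedIdeal (Φ : (ℕ →₀ ℝ) → ℝ) : Set (E →L[ℂ] E) :=
  {x | idealNorm Φ x < ∞}

/-- The norm `‖·‖_Φ` on complex `n × n` matrices, viewed as operators on `ℂⁿ`. -/
def matIdealNorm (Φ : (ℕ →₀ ℝ) → ℝ) {n : ℕ} (A : Matrix (Fin n) (Fin n) ℂ) : ℝ≥0∞ :=
  idealNorm Φ (Matrix.toEuclideanCLM (n := Fin n) (𝕜 := ℂ) A)

end Operators

section Spaces

variable {H : Type*} [NormedAddCommGroup H] [InnerProductSpace ℂ H]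

/-- The operator `x ⊗ a` on the Hilbert space tensor product, i.e. on the completion of the
algebraic tensor product with its inner product. -/
def tensorOp (x a : H →L[ℂ] H) :
    UniformSpace.Completion (H ⊗[ℂ] H) →L[ℂ] UniformSpace.Completion (H ⊗[ℂ] H) :=
  ((UniformSpace.Completion.toComplL (𝕜 := ℂ) (E := H ⊗[ℂ] H)).comp
    (TensorProduct.mapL x a)).extend
      (UniformSpace.Completion.toComplL (𝕜 := ℂ) (E := H ⊗[ℂ] H))

theorem tensorOp_tmul (x a : H →L[ℂ] H) (v w : H) :
    tensorOp x a ((v ⊗ₜ[ℂ] w : H ⊗[ℂ] H) : UniformSpace.Completion (H ⊗[ℂ] H)) =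
      ((x v ⊗ₜ[ℂ] a w : H ⊗[ℂ] H) : UniformSpace.Completion (H ⊗[ℂ] H)) := by
  have h := ContinuousLinearMap.extend_eq
    (f := (UniformSpace.Completion.toComplL (𝕜 := ℂ) (E := H ⊗[ℂ] H)).comp
      (TensorProduct.mapL x a))
    (e := UniformSpace.Completion.toComplL (𝕜 := ℂ) (E := H ⊗[ℂ] H))
    UniformSpace.Completion.denseRange_coe
    (UniformSpace.Completion.isUniformInducing_coe _) (v ⊗ₜ[ℂ] w)
  exact h

/-! ### Matrix norms on a Hilbert space; `M_n(H) = H ⊗ M_n` -/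

variable (H) in
/-- A family of (extended) functionals on the spaces `M_n(H)`. -/
abbrev MatrixNorms : Type _ := ∀ n : ℕ, Matrix (Fin n) (Fin n) H → ℝ≥0∞

/-- For `T = ∑ ξ_m ⊗ T_m` with `(ξ_m)` orthonormal, `ρ_T(x) = ∑ T_m x T_m^*`, written without
reference to `(ξ_m)`; see `rho_eq_sum`. -/
def rho {n : ℕ} (T : Matrix (Fin n) (Fin n) H) (x : Matrix (Fin n) (Fin n) ℂ) :
    Matrix (Fin n) (Fin n) ℂ :=
  Matrix.of fun i l => ∑ j, ∑ k, inner ℂ (T l k) (T i j) * x j k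

/-- For `T = ∑ ξ_m ⊗ T_m` with `(ξ_m)` orthonormal, the matrix `∑ T_m^* T_m`; see
`colGram_eq_sum`. -/
def colGram {n : ℕ} (T : Matrix (Fin n) (Fin n) H) : Matrix (Fin n) (Fin n) ℂ :=
  Matrix.of fun j k => ∑ i, inner ℂ (T i j) (T i k)

theorem inner_sum_smul {ι : Type*} [Fintype ι] {ξ : ι → H} (hξ : Orthonormal ℂ ξ) (a b : ι → ℂ) :
    inner ℂ (∑ m, a m • ξ m) (∑ m, b m • ξ m) = ∑ m, star (a m) * b m := by
  rw [hξ.inner_sum]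
  rfl

theorem rho_eq_sum {ι : Type*} [Fintype ι] {ξ : ι → H} (hξ : Orthonormal ℂ ξ) {n : ℕ}
    (A : ι → Matrix (Fin n) (Fin n) ℂ) (x : Matrix (Fin n) (Fin n) ℂ) :
    rho (Matrix.of fun i j => ∑ m, A m i j • ξ m) x =
      ∑ m, A m * x * (A m).conjTranspose := by
  ext i l
  simp only [rho, Matrix.of_apply, inner_sum_smul hξ, Matrix.sum_apply, Matrix.mul_apply,
    Matrix.conjTranspose_apply, Finset.sum_mul]
  rw [Finset.sum_comm]
  simp_rw [Finset.sum_comm (s := (Finset.univ : Finset (Fin n)))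
    (t := (Finset.univ : Finset ι))]
  refine Finset.sum_congr rfl fun m _ => Finset.sum_congr rfl fun k _ =>
    Finset.sum_congr rfl fun j _ => by ring

theorem colGram_eq_sum {ι : Type*} [Fintype ι] {ξ : ι → H} (hξ : Orthonormal ℂ ξ) {n : ℕ}
    (A : ι → Matrix (Fin n) (Fin n) ℂ) :
    colGram (Matrix.of fun i j => ∑ m, A m i j • ξ m) =
      ∑ m, (A m).conjTranspose * A m := by
  ext j k
  simp only [colGram, Matrix.of_apply, inner_sum_smul hξ, Matrix.sum_apply, Matrix.mul_apply,
    Matrix.conjTranspose_apply]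
  rw [Finset.sum_comm]

open scoped Matrix.Norms.L2Operator in
variable (H) in
/-- The row Hilbert space `R`: `‖∑ ξ_m ⊗ T_m‖ = ‖∑ T_m T_m^*‖ ^ (1/2)`. -/
def rowSpace : MatrixNorms H := fun _ T => ENNReal.ofReal (Real.sqrt ‖rho T 1‖)

open scoped Matrix.Norms.L2Operator in
variable (H) in
/-- The column Hilbert space `C`: `‖∑ ξ_m ⊗ T_m‖ = ‖∑ T_m^* T_m‖ ^ (1/2)`. -/
def colSpace : MatrixNorms H := fun _ T => ENNReal.ofReal (Real.sqrt ‖colGram T‖)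

variable (H) in
/-- The space `H(Φ, Ψ)`: `‖T‖_{Φ,Ψ} = ‖ρ_T : 𝔖_Φ → 𝔖_Ψ‖ ^ (1/2)`. -/
def hSpace (Φ Ψ : (ℕ →₀ ℝ) → ℝ) : MatrixNorms H := fun _ T =>
  (⨆ x, matIdealNorm Ψ (rho T x) / matIdealNorm Φ x) ^ (1 / 2 : ℝ)

/-- The completely bounded norm of a linear map `u`, i.e. the supremum over `n` of the norms of
`id_n ⊗ u : M_n(E) → M_n(F)`. -/
def cbNorm (E F : MatrixNorms H) (u : H →ₗ[ℂ] H) : ℝ≥0∞ :=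
  ⨆ (n : ℕ) (T : Matrix (Fin n) (Fin n) H), F n (T.map u) / E n T

/-- The set `CB(E, F)` of completely bounded linear maps. -/
def CB (E F : MatrixNorms H) : Set (H →ₗ[ℂ] H) := {u | cbNorm E F u < ∞}

open scoped Matrix.Norms.L2Operator in
/-- `H` with the given matrix norms is an operator space: the functionals are norms, the first one
is the norm of `H`, and Ruan's axioms (M1) and (M2) hold. -/
structure IsOperatorSpace (N : MatrixNorms H) : Prop where
  ne_top : ∀ n T, N n T ≠ ∞
  eq_zero_iff : ∀ n T, N n T = 0 ↔ T = 0
  add_le : ∀ n S T, N n (S + T) ≤ N n S + N n T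
  smul : ∀ n (c : ℂ) T, N n (c • T) = ‖c‖ₑ * N n T
  base : ∀ v : H, N 1 (Matrix.of fun _ _ => v) = ‖v‖ₑ
  ruan_one : ∀ m n (S : Matrix (Fin m) (Fin m) H) (T : Matrix (Fin n) (Fin n) H),
    N (m + n) (Matrix.reindex finSumFinEquiv finSumFinEquiv (Matrix.fromBlocks S 0 0 T)) =
      max (N m S) (N n T)
  ruan_two : ∀ m n (T : Matrix (Fin m) (Fin m) H) (a : Matrix (Fin n) (Fin m) ℂ)
    (b : Matrix (Fin m) (Fin n) ℂ),
    N n (Matrix.of fun i j => ∑ k, ∑ l, (a i k * b l j) • T k l) ≤ ‖a‖ₑ * N m T * ‖b‖ₑ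

/-- `CB(E, F) = S` isometrically, where the operators in `S` carry the norm `‖·‖_Θ`. -/
def CBIsometricEq (E F : MatrixNorms H) (S : Set (H →L[ℂ] H)) (Θ : (ℕ →₀ ℝ) → ℝ) : Prop :=
  CB E F = (fun x : H →L[ℂ] H => (x : H →ₗ[ℂ] H)) '' S ∧
    ∀ x ∈ S, cbNorm E F (x : H →ₗ[ℂ] H) = idealNorm Θ x

/-- The isometric identification of `CB(E, F)` with the ideal of `Θ`. In general it is with all
bounded operators of finite `Θ`-norm; if `Θ` is not equivalent to the sup norm, it is with `𝔖_Θ`. -/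
def CBIdentification (E F : MatrixNorms H) (Θ : (ℕ →₀ ℝ) → ℝ) : Prop :=
  CBIsometricEq E F (boundedIdeal Θ) Θ ∧
    (¬ SupEquivalent Θ → CBIsometricEq E F (symmIdeal Θ) Θ)

variable (H) in
/-- The inequality `‖x ⊗ y‖_Ψ / ‖x‖_Ψ ≤ ‖z ⊗ y‖_Φ / ‖z‖_Φ` for `x, y, z ∈ 𝔖_Φ`, `x, z ≠ 0`. -/
def CrossInequality (Φ Ψ : (ℕ →₀ ℝ) → ℝ) : Prop :=
  ∀ x ∈ symmIdeal (E := H) Φ, ∀ y ∈ symmIdeal (E := H) Φ, ∀ z ∈ symmIdeal (E := H) Φ,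
    x ≠ 0 → z ≠ 0 →
      idealNorm Ψ (tensorOp x y) / idealNorm Ψ x ≤ idealNorm Φ (tensorOp z y) / idealNorm Φ z

end Spaces

end NormedIdeals

end

noncomputable section

namespace NormedIdeals

section

/-! ### Symmetric norming functions -/

/-! Part (a) is a compression argument. Fix an orthonormal sequence `b` with trivial orthogonal
complement. To `T` in `M_n(H)` belongs the operator `Z : ℂⁿ → H ⊗ H` with `Z e_l = ∑ k, T l k ⊗ b
k`. Its squared norm is that of `T` in `R`, and if `a` has the transposed matrix of `y` in the basis
`b`, then `Z* (|x|² ⊗ a) Z` is the transpose of `ρ(y)` formed with `x T`. This bounds the cb-norm by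
the supremum (`hSq_map_le`). Conversely, let `T` be block diagonal with equal blocks, each having `b
0, …, b m` as its first column. It has norm at most one in `R`, and `ρ` formed with `x T` produces
the transposed compressions of `|x|² ⊗ a` to the vectors `b i ⊗ b j` (`mNorm_tMat_le_hSq`). As `m`
grows these exhaust `|x|² ⊗ a`, because `‖·‖_Ψ` is lower semicontinuous for strong convergence
(`idealNorm_le_of_tendsto`).

For the row identifications in (b) and (c) the supremum has to equal `‖ |x|² ‖_Ψ`, which is `‖x‖²`
for the 2-convexification since `s_k(x* x) = s_k(x)²` (`sNumber_star_mul_self`). A rank-one `a`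
gives one inequality. For the other, the cross inequality with a rank-one `z` says `‖x ⊗ y‖_Ψ ≤
‖x‖_Ψ ‖y‖_Φ`; alternatively, axiom (M1) removes the repetition of blocks, and a single column only
sees one entry of `y`.

The column identifications follow by transposition. It exchanges `R` and `C`, and since `ρ` of the
transpose of `T` is, up to transposes, the trace adjoint of `ρ_T`, it carries `H(Φ, Ψ)` to `H(Ψ*,
Φ*)` (`hSq_transpose`). This rests on the duality of the matrix norms of `Φ` and `Φ*` (von Neumann's
trace inequality) and on `Φ** = Φ` (Hahn–Banach). Finally, a finite norm `‖x‖_Θ` forces `s_k(x) →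
0`, hence compactness, unless `Θ` is equivalent to the sup norm. -/

theorem trunc_apply (s : ℕ → ℝ) (n i : ℕ) : trunc s n i = if i < n then s i else 0 := rfl

/-- The rearrangement `i ↦ |ξ (σ i)|`. -/
def absPerm (σ : Equiv.Perm ℕ) (ξ : ℕ →₀ ℝ) : ℕ →₀ ℝ :=
  (ξ.mapRange (fun t : ℝ => |t|) abs_zero).equivMapDomain σ.symm

theorem absPerm_apply (σ : Equiv.Perm ℕ) (ξ : ℕ →₀ ℝ) (i : ℕ) : absPerm σ ξ i = |ξ (σ i)| := by
  simp [absPerm]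

namespace IsSNFunction

variable {Φ : (ℕ →₀ ℝ) → ℝ} (hΦ : IsSNFunction Φ)
include hΦ

theorem map_absPerm (σ : Equiv.Perm ℕ) (ξ : ℕ →₀ ℝ) : Φ (absPerm σ ξ) = Φ ξ := hΦ.symm _ _

theorem map_zero : Φ 0 = 0 := by simpa using hΦ.smul 0 0

theorem congr_abs {ξ η : ℕ →₀ ℝ} (h : ∀ i, |ξ i| = |η i|) : Φ ξ = Φ η := by
  rw [← hΦ.map_absPerm 1 ξ, ← hΦ.map_absPerm 1 η]
  congr 1
  ext i
  simp [absPerm_apply, h]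

theorem nonneg (ξ : ℕ →₀ ℝ) : 0 ≤ Φ ξ := by
  have h := hΦ.add_le ξ (-ξ)
  rw [add_neg_cancel, hΦ.map_zero, hΦ.congr_abs (ξ := -ξ) (η := ξ) (by simp)] at h
  linarith

theorem pos {ξ : ℕ →₀ ℝ} (h : ξ ≠ 0) : 0 < Φ ξ :=
  (hΦ.nonneg ξ).lt_of_ne fun h' => h (hΦ.eq_zero ξ h'.symm)

/-- If `ξ a = t * η a` with `|t| ≤ 1`, then `ξ` is the convex combination, with weights `(1 ± t) /
2`, of `η` and of `η` with the sign of its entry at `a` flipped; both have the same norm. -/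
theorem mono_single {ξ η : ℕ →₀ ℝ} (a : ℕ) (ha : |ξ a| ≤ |η a|) (h : ∀ i, i ≠ a → ξ i = η i) :
    Φ ξ ≤ Φ η := by
  by_cases h0 : η a = 0
  · have : ξ = η := by
      ext i
      by_cases hi : i = a
      · subst hi
        rw [h0, abs_zero] at ha
        rw [h0, abs_nonpos_iff.1 ha]
      · exact h i hi
    rw [this]
  set t := ξ a / η a with ht
  have hξa : ξ a = t * η a := by rw [ht]; field_simp
  have ht1 : |t| ≤ 1 := by
    rw [ht, abs_div]
    exact div_le_one_of_le₀ ha (abs_nonneg _)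
  obtain ⟨h1, h2⟩ := abs_le.1 ht1
  set η' := η.update a (-η a) with hη'
  have e1 : Φ η' = Φ η := hΦ.congr_abs fun i => by
    by_cases hi : i = a
    · subst hi; simp [hη']
    · simp [hη', Function.update_of_ne hi]
  have e2 : ξ = ((1 + t) / 2) • η + ((1 - t) / 2) • η' := by
    ext i
    by_cases hi : i = a
    · subst hi; simp [hη', hξa]; ring
    · simp [hη', Function.update_of_ne hi, h i hi]; ring
  rw [e2]
  refine (hΦ.add_le _ _).trans ?_
  rw [hΦ.smul, hΦ.smul, e1, abs_of_nonneg (by linarith), abs_of_nonneg (by linarith)]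
  apply le_of_eq
  ring

theorem mono {ξ η : ℕ →₀ ℝ} (h : ∀ i, |ξ i| ≤ |η i|) : Φ ξ ≤ Φ η := by
  have key : ∀ (S : Finset ℕ) (ξ : ℕ →₀ ℝ), (∀ i, |ξ i| ≤ |η i|) → (∀ i, i ∉ S → ξ i = η i) →
      Φ ξ ≤ Φ η := by
    intro S
    induction S using Finset.induction_on with
    | empty =>
      intro ξ _ h2
      rw [show ξ = η from Finsupp.ext fun i => h2 i (by simp)]
    | insert a S _ ih =>
      intro ξ h1 h2
      refine (hΦ.mono_single (η := ξ.update a (η a)) a (by simpa using h1 a) fun i hi => by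
        simp [Function.update_of_ne hi]).trans (ih _ (fun i => ?_) fun i hi => ?_)
      · by_cases hia : i = a
        · subst hia; simp
        · simpa [Function.update_of_ne hia] using h1 i
      · by_cases hia : i = a
        · subst hia; simp
        · simpa [Function.update_of_ne hia] using h2 i (by simp [hia, hi])
  refine key (ξ.support ∪ η.support) ξ h fun i hi => ?_
  simp only [Finset.mem_union, Finsupp.mem_support_iff, not_or, not_not] at hi
  rw [hi.1, hi.2]

theorem map_single (i : ℕ) (c : ℝ) : Φ (Finsupp.single i c) = |c| := by
  have h : absPerm (Equiv.swap 0 i) (Finsupp.single i c) = |c| • Finsupp.single 0 1 := by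
    ext j
    rw [absPerm_apply]
    by_cases hj : j = 0
    · subst hj; simp
    · have : ¬ (i = Equiv.swap 0 i j) := fun h => hj (by
        have := congrArg (Equiv.swap 0 i) h
        simpa using this.symm)
      simp [this, Ne.symm hj]
  rw [← hΦ.map_absPerm (Equiv.swap 0 i), h, hΦ.smul, hΦ.normalized, mul_one, abs_abs]

theorem abs_apply_le (ξ : ℕ →₀ ℝ) (i : ℕ) : |ξ i| ≤ Φ ξ := by
  rw [← hΦ.map_single i (ξ i)]
  refine hΦ.mono fun j => ?_
  by_cases hj : i = j
  · subst hj; simp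
  · simp [hj]

theorem trunc_mono_left {s t : ℕ → ℝ} (n : ℕ) (h : ∀ i < n, |s i| ≤ |t i|) :
    Φ (trunc s n) ≤ Φ (trunc t n) := by
  refine hΦ.mono fun i => ?_
  simp only [trunc_apply]
  split_ifs with hi
  · exact h i hi
  · simp

theorem trunc_smul (c : ℝ) (s : ℕ → ℝ) (n : ℕ) :
    Φ (trunc (fun i => c * s i) n) = |c| * Φ (trunc s n) := by
  rw [← hΦ.smul]
  congr 1
  ext i
  simp [trunc_apply]

end IsSNFunction

/-! ### The adjoint -/

/-- Only an initial segment containing the support is sorted, so the permutation moves finitely many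
indices and finite sums can be reindexed along it. -/
theorem exists_sort (η : ℕ →₀ ℝ) {N : ℕ} (hN : η.support ⊆ Finset.range N) :
    ∃ σ : Equiv.Perm ℕ, (∀ i, N ≤ i → σ i = i) ∧ Antitone fun i => |η (σ i)| := by
  let f : Fin N → ℝ := fun i => -|η i|
  let σ := (Tuple.sort f).extendDomain Fin.equivSubtype
  have hlt : ∀ i (hi : i < N), σ i = (Tuple.sort f ⟨i, hi⟩ : ℕ) := fun i hi => by
    simpa using Equiv.Perm.extendDomain_apply_subtype (Tuple.sort f) Fin.equivSubtype
      (b := i) hi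
  have hge : ∀ i, N ≤ i → σ i = i := fun i hi =>
    Equiv.Perm.extendDomain_apply_not_subtype _ _ (by omega)
  refine ⟨σ, hge, fun i j hij => ?_⟩
  dsimp only
  by_cases hj : j < N
  · have hi : i < N := by omega
    rw [hlt i hi, hlt j hj]
    have := Tuple.monotone_sort f (show (⟨i, hi⟩ : Fin N) ≤ ⟨j, hj⟩ from hij)
    simpa [f] using this
  · have : η j = 0 := by
      by_contra h
      exact hj (Finset.mem_range.1 (hN (Finsupp.mem_support_iff.2 h)))
    rw [hge j (by omega), this]
    simp

theorem exists_support_subset_range (η : ℕ →₀ ℝ) : ∃ N, ∀ M ≥ N, η.support ⊆ Finset.range M := by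
  obtain ⟨N, hN⟩ := η.support.exists_nat_subset_range
  exact ⟨N, fun M hM => hN.trans (Finset.range_mono hM)⟩

/-- For `t ≥ 0`, at most `i` entries exceed `t` exactly when the `i`-th sorted entry does not, so
the set in the definition is a closed half-line. Any sorting permutation may therefore compute the
rearrangement. -/
theorem decrRearr_eq (η : ℕ →₀ ℝ) {σ : Equiv.Perm ℕ} (h : Antitone fun i => |η (σ i)|) (i : ℕ) :
    decrRearr η i = |η (σ i)| := by
  have hcard : ∀ t : ℝ, 0 ≤ t → ((η.support.filter (fun j => t < |η j|)).card ≤ i ↔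
      |η (σ i)| ≤ t) := by
    intro t ht
    constructor
    · intro hc
      by_contra! hlt
      have hsub : (Finset.range (i + 1)).map σ.toEmbedding ⊆
          η.support.filter (fun j => t < |η j|) := by
        intro j hj
        obtain ⟨k, hk, rfl⟩ := Finset.mem_map.1 hj
        have hk' : t < |η (σ k)| := hlt.trans_le (h (Nat.lt_succ_iff.1 (Finset.mem_range.1 hk)))
        refine Finset.mem_filter.2 ⟨Finsupp.mem_support_iff.2 fun h0 => ?_, hk'⟩
        have h0' : η (σ k) = 0 := h0
        rw [h0', abs_zero] at hk'
        exact absurd hk' (not_lt.2 ht)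
      have := Finset.card_le_card hsub
      rw [Finset.card_map, Finset.card_range] at this
      omega
    · intro hle
      have hsub : η.support.filter (fun j => t < |η j|) ⊆
          (Finset.range i).map σ.toEmbedding := by
        intro j hj
        refine Finset.mem_map.2 ⟨σ.symm j, Finset.mem_range.2 ?_, by simp⟩
        by_contra! hge
        have h1 := h hge
        simp only [Equiv.apply_symm_apply] at h1
        exact absurd (Finset.mem_filter.1 hj).2 (not_lt.2 (h1.trans hle))
      simpa using Finset.card_le_card hsub
  have hset : {t : ℝ | 0 ≤ t ∧ (η.support.filter (fun j => t < |η j|)).card ≤ i} =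
      Set.Ici |η (σ i)| := by
    ext t
    constructor
    · rintro ⟨h1, h2⟩
      exact (hcard t h1).1 h2
    · intro h1
      have h0 : 0 ≤ t := (abs_nonneg _).trans h1
      exact ⟨h0, (hcard t h0).2 h1⟩
  rw [decrRearr, hset, csInf_Ici]

section Adjoint

variable {Φ : (ℕ →₀ ℝ) → ℝ} (hΦ : IsSNFunction Φ)
include hΦ

theorem adjointFn_nonneg (η : ℕ →₀ ℝ) : 0 ≤ adjointFn Φ η := by
  refine Real.sSup_nonneg ?_
  rintro r ⟨ξ, -, h, -, rfl⟩
  refine div_nonneg (Finset.sum_nonneg fun i _ => mul_nonneg ?_ (h i)) (hΦ.nonneg _)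
  exact Real.sInf_nonneg fun t ht => ht.1

theorem le_adjointFn (η ξ : ℕ →₀ ℝ) (h0 : ∀ i, 0 ≤ ξ i) (h1 : Antitone fun i => ξ i) :
    (ξ.sum fun i c => decrRearr η i * c) ≤ adjointFn Φ η * Φ ξ := by
  by_cases hξ : ξ = 0
  · simp [hξ, hΦ.map_zero]
  rw [← div_le_iff₀ (hΦ.pos hξ)]
  refine le_csSup ?_ ⟨ξ, hξ, h0, h1, rfl⟩
  obtain ⟨N, hN⟩ := exists_support_subset_range η
  obtain ⟨σ, hσ, hσa⟩ := exists_sort η (hN N le_rfl)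
  -- The supremum is only meaningful once the set is bounded. The ℓ¹ norm of `η` is a bound, as
  -- every entry of `ζ` is at most `Φ ζ`.
  refine ⟨∑ i ∈ Finset.range N, |η (σ i)|, ?_⟩
  rintro r ⟨ζ, hζ, hζ0, -, rfl⟩
  rw [div_le_iff₀ (hΦ.pos hζ), Finsupp.sum, Finset.sum_mul]
  refine (Finset.sum_le_sum_of_subset_of_nonneg (t := ζ.support ∪ Finset.range N)
    Finset.subset_union_left fun i _ _ => ?_).trans ?_
  · rw [decrRearr_eq η hσa]
    exact mul_nonneg (abs_nonneg _) (hζ0 i)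
  rw [← Finset.sum_subset (s₁ := Finset.range N) Finset.subset_union_right]
  · refine Finset.sum_le_sum fun i _ => ?_
    rw [decrRearr_eq η hσa]
    exact mul_le_mul_of_nonneg_left ((le_abs_self _).trans (hΦ.abs_apply_le ζ i)) (abs_nonneg _)
  · intro i _ hi
    rw [decrRearr_eq η hσa, hσ i (by simpa using hi)]
    have : η i = 0 := by
      by_contra h
      exact hi (hN N le_rfl (Finsupp.mem_support_iff.2 h))
    simp [this]

/-- The rearrangement inequality: sorting both sequences can only increase the pairing. With
`adjointFn_le` this describes `Φ*` as a dual norm with arbitrary, unsorted test sequences, and in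
that form the norm axioms are immediate. -/
theorem sum_abs_mul_abs_le (η ξ : ℕ →₀ ℝ) (n : ℕ) :
    ∑ i ∈ Finset.range n, |η i| * |ξ i| ≤ adjointFn Φ η * Φ ξ := by
  obtain ⟨N₁, hN₁⟩ := exists_support_subset_range η
  obtain ⟨N₂, hN₂⟩ := exists_support_subset_range ξ
  set N := max n (max N₁ N₂) with hN
  obtain ⟨σ, hσ, hσa⟩ := exists_sort η (hN₁ N (by omega))
  obtain ⟨τ, hτ, hτa⟩ := exists_sort ξ (hN₂ N (by omega))
  have hfix : ∀ π : Equiv.Perm ℕ, (∀ i, N ≤ i → π i = i) →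
      {a | π a ≠ a} ⊆ (Finset.range N : Set ℕ) := by
    intro π hπ a ha
    by_contra h
    exact ha (hπ a (by simpa using h))
  calc ∑ i ∈ Finset.range n, |η i| * |ξ i|
      ≤ ∑ i ∈ Finset.range N, |η i| * |ξ i| :=
        Finset.sum_le_sum_of_subset_of_nonneg (Finset.range_mono (by omega))
          fun i _ _ => by positivity
    _ = ∑ i ∈ Finset.range N, |η (σ i)| * |ξ (σ i)| :=
        (Equiv.Perm.sum_comp σ _ (fun i => |η i| * |ξ i|) (hfix σ hσ)).symm
    _ = ∑ i ∈ Finset.range N, |η (σ i)| * |ξ (τ ((σ.trans τ.symm) i))| := by simp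
    _ ≤ ∑ i ∈ Finset.range N, |η (σ i)| * |ξ (τ i)| := by
        refine MonovaryOn.sum_mul_comp_perm_le_sum_mul (σ := σ.trans τ.symm)
          (f := fun i => |η (σ i)|) (g := fun i => |ξ (τ i)|) ?_ (hfix _ fun i hi => ?_)
        · exact (hσa.monovary hτa).monovaryOn _
        · rw [Equiv.trans_apply, hσ i hi, Equiv.symm_apply_eq, hτ i hi]
    _ = (absPerm τ ξ).sum fun i c => decrRearr η i * c := by
        rw [Finsupp.sum, ← Finset.sum_subset (s₂ := Finset.range N)
          (s₁ := (absPerm τ ξ).support)]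
        · simp [absPerm_apply, decrRearr_eq η hσa]
        · intro i hi
          by_contra h
          have hi' : N ≤ i := by simpa using h
          rw [Finsupp.mem_support_iff, absPerm_apply, hτ i hi', abs_ne_zero] at hi
          exact h (hN₂ N (by omega) (Finsupp.mem_support_iff.2 hi))
        · intro i _ hi
          rw [Finsupp.notMem_support_iff, absPerm_apply] at hi
          simp [hi]
    _ ≤ adjointFn Φ η * Φ (absPerm τ ξ) :=
        le_adjointFn hΦ _ _ (fun i => by simp [absPerm_apply]) (by simpa [absPerm_apply] using hτa)
    _ = adjointFn Φ η * Φ ξ := by rw [hΦ.map_absPerm]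

/-- A sorted test sequence is moved back by the inverse of the permutation sorting `η`, which does
not change its norm. -/
theorem adjointFn_le (η : ℕ →₀ ℝ) {c : ℝ} (hc : 0 ≤ c)
    (h : ∀ (ξ : ℕ →₀ ℝ) (n : ℕ), ∑ i ∈ Finset.range n, |η i| * |ξ i| ≤ c * Φ ξ) :
    adjointFn Φ η ≤ c := by
  refine Real.sSup_le ?_ hc
  rintro r ⟨ξ, hξ, h0, h1, rfl⟩
  rw [div_le_iff₀ (hΦ.pos hξ)]
  obtain ⟨N₁, hN₁⟩ := exists_support_subset_range η
  obtain ⟨N₂, hN₂⟩ := exists_support_subset_range ξ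
  set N := max N₁ N₂ with hN
  obtain ⟨σ, hσ, hσa⟩ := exists_sort η (hN₁ N (by omega))
  rw [Finsupp.sum]
  refine (Finset.sum_le_sum_of_subset_of_nonneg (hN₂ N (by omega)) fun i _ _ => ?_).trans ?_
  · rw [decrRearr_eq η hσa]
    exact mul_nonneg (abs_nonneg _) (h0 i)
  rw [← hΦ.map_absPerm σ.symm]
  refine le_trans (le_of_eq ?_) (h (absPerm σ.symm ξ) N)
  rw [← Equiv.Perm.sum_comp σ (Finset.range N) (fun i => |η i| * |absPerm σ.symm ξ i|)]
  · refine Finset.sum_congr rfl fun i _ => ?_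
    rw [decrRearr_eq η hσa, absPerm_apply]
    simp [abs_of_nonneg (h0 i)]
  · intro a ha
    by_contra h
    exact ha (hσ a (by simpa using h))

theorem isSNFunction_adjointFn : IsSNFunction (adjointFn Φ) := by
  have hsmul : ∀ (c : ℝ) η, adjointFn Φ (c • η) ≤
      |c| * adjointFn Φ η := by
    intro c η
    refine adjointFn_le hΦ _ (mul_nonneg (abs_nonneg _) (adjointFn_nonneg hΦ _)) fun ξ n => ?_
    calc ∑ i ∈ Finset.range n, |(c • η) i| * |ξ i|
        = |c| * ∑ i ∈ Finset.range n, |η i| * |ξ i| := by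
          rw [Finset.mul_sum]
          exact Finset.sum_congr rfl fun i _ => by simp [abs_mul, mul_assoc]
      _ ≤ _ := by
          rw [mul_assoc]
          exact mul_le_mul_of_nonneg_left (sum_abs_mul_abs_le hΦ η ξ n) (abs_nonneg _)
  refine ⟨fun ξ η => ?_, fun c η => ?_, fun η h => ?_, ?_, fun σ η => ?_⟩
  · refine adjointFn_le hΦ _ (add_nonneg (adjointFn_nonneg hΦ _) (adjointFn_nonneg hΦ _))
      fun ζ n => ?_
    rw [add_mul]
    refine le_trans ?_ (add_le_add (sum_abs_mul_abs_le hΦ ξ ζ n) (sum_abs_mul_abs_le hΦ η ζ n))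
    rw [← Finset.sum_add_distrib]
    refine Finset.sum_le_sum fun i _ => ?_
    rw [← add_mul]
    exact mul_le_mul_of_nonneg_right (abs_add_le _ _) (abs_nonneg _)
  · refine le_antisymm (hsmul c η) ?_
    by_cases hc : c = 0
    · simpa [hc] using adjointFn_nonneg hΦ _
    · have := hsmul c⁻¹ (c • η)
      rw [smul_smul, inv_mul_cancel₀ hc, one_smul, abs_inv] at this
      rwa [← le_inv_mul_iff₀ (abs_pos.2 hc)]
  · ext i
    have h1 := sum_abs_mul_abs_le hΦ η η (i + 1)
    rw [h, zero_mul] at h1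
    have h2 := (Finset.sum_eq_zero_iff_of_nonneg fun j _ => by positivity).1
      (le_antisymm h1 (Finset.sum_nonneg fun j _ => by positivity)) i (by simp)
    simpa using h2
  · refine le_antisymm (adjointFn_le hΦ _ zero_le_one fun ξ n => ?_) ?_
    · rw [one_mul]
      refine le_trans ?_ (hΦ.abs_apply_le ξ 0)
      calc ∑ i ∈ Finset.range n, |Finsupp.single 0 (1 : ℝ) i| * |ξ i|
          ≤ ∑ i ∈ Finset.range (n + 1), |Finsupp.single 0 (1 : ℝ) i| * |ξ i| :=
            Finset.sum_le_sum_of_subset_of_nonneg (Finset.range_mono (by omega))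
              fun i _ _ => by positivity
        _ = |ξ 0| := by
            rw [Finset.sum_eq_single 0]
            · simp
            · intro i _ hi
              simp [Ne.symm hi]
            · simp
    · have := sum_abs_mul_abs_le hΦ (Finsupp.single 0 1) (Finsupp.single 0 1) 1
      simpa [hΦ.normalized] using this
  · have hle : ∀ (σ : Equiv.Perm ℕ) η, adjointFn Φ (absPerm σ η) ≤
        adjointFn Φ η := by
      intro σ η
      refine adjointFn_le hΦ _ (adjointFn_nonneg hΦ _) fun ξ n => ?_
      obtain ⟨N, hN⟩ := ((Finset.range n).map σ.toEmbedding).exists_nat_subset_range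
      rw [← hΦ.map_absPerm σ.symm]
      refine le_trans ?_ (sum_abs_mul_abs_le hΦ η (absPerm σ.symm ξ) N)
      refine le_trans (le_of_eq ?_) (Finset.sum_le_sum_of_subset_of_nonneg hN
        fun i _ _ => by positivity)
      rw [Finset.sum_map]
      exact Finset.sum_congr rfl fun i _ => by simp [absPerm_apply]
    -- For the reverse inequality, the inverse permutation restores `η` up to signs, and signs do
    -- not affect the pairings.
    refine le_antisymm (hle σ.symm η) ?_
    have h1 := hle σ (absPerm σ.symm η)
    have h2 := hle 1 (absPerm 1 η)
    have h3 : absPerm σ (absPerm σ.symm η) = absPerm 1 η := by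
      ext i
      simp [absPerm_apply]
    have h4 : adjointFn Φ η ≤ adjointFn Φ (absPerm 1 η) := by
      refine adjointFn_le hΦ _ (adjointFn_nonneg hΦ _) fun ξ n => ?_
      simpa [absPerm_apply] using sum_abs_mul_abs_le hΦ (absPerm 1 η) ξ n
    rw [h3] at h1
    exact h4.trans h1

theorem adjointFn_antitone {Ψ : (ℕ →₀ ℝ) → ℝ} (hΨ : IsSNFunction Ψ)
    (hle : ∀ ξ, Ψ ξ ≤ Φ ξ) (η : ℕ →₀ ℝ) :
    adjointFn Φ η ≤ adjointFn Ψ η :=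
  adjointFn_le hΦ _ (adjointFn_nonneg hΨ _) fun ξ n => (sum_abs_mul_abs_le hΨ η ξ n).trans
    (mul_le_mul_of_nonneg_left (hle ξ) (adjointFn_nonneg hΨ _))

/-- `Φ** = Φ`. -/
theorem adjointFn_adjointFn (η : ℕ →₀ ℝ) :
    adjointFn (adjointFn Φ) η = Φ η := by
  have hA := isSNFunction_adjointFn hΦ
  refine le_antisymm (adjointFn_le hA _ (hΦ.nonneg η) fun ξ n => ?_) ?_
  · rw [mul_comm]
    simpa [mul_comm] using sum_abs_mul_abs_le hΦ ξ η n
  by_cases hη : η = 0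
  · rw [hη, hΦ.map_zero]
    exact adjointFn_nonneg hA _
  -- Hahn–Banach: a linear functional dominated by `Φ` that takes the value `Φ η` at `η`. Its
  -- coefficients on the support of `η` form the sequence `f`, which norms `η`.
  obtain ⟨g, hg1, hg2⟩ := exists_extension_of_le_sublinear
    (LinearPMap.mkSpanSingleton (K := ℝ) η (Φ η) hη) Φ
    (fun c hc x => by rw [hΦ.smul, abs_of_pos hc]) hΦ.add_le (by
      rintro ⟨x, hx⟩
      obtain ⟨c, rfl⟩ := Submodule.mem_span_singleton.1 hx
      rw [LinearPMap.mkSpanSingleton'_apply, hΦ.smul]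
      exact mul_le_mul_of_nonneg_right (le_abs_self c) (hΦ.nonneg _))
  obtain ⟨N, hN⟩ := exists_support_subset_range η
  have hN := hN N le_rfl
  let f : ℕ →₀ ℝ := trunc (fun i => g (Finsupp.single i 1)) N
  have hf : adjointFn Φ f ≤ 1 := by
    refine adjointFn_le hΦ _ zero_le_one fun ξ n => ?_
    -- Giving `|ξ|` the signs of `f` turns the pairing of absolute values into `g ζ`, which is at
    -- most `Φ ζ ≤ Φ ξ`. Beyond `N` the sign is zero, matching the truncation of `f`.
    let ζ : ℕ →₀ ℝ := ∑ i ∈ Finset.range n, Finsupp.single i (SignType.sign (f i) * |ξ i|)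
    have hζ : ∀ j, ζ j = if j < n then SignType.sign (f j) * |ξ j| else 0 := by
      intro j
      simp [ζ, Finsupp.finsetSum_apply, Finsupp.single_apply]
    have h1 : ∑ i ∈ Finset.range n, |f i| * |ξ i| = g ζ := by
      rw [map_sum]
      refine Finset.sum_congr rfl fun i _ => ?_
      have : Finsupp.single i ((SignType.sign (f i) : ℝ) * |ξ i|) =
          ((SignType.sign (f i) : ℝ) * |ξ i|) • Finsupp.single i 1 := by simp
      rw [this, map_smul, smul_eq_mul]
      by_cases hi : i < N
      · have : f i = g (Finsupp.single i 1) := by simp [f, trunc_apply, hi]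
        rw [← this]
        have h2 := sign_mul_self (f i)
        rw [← h2]
        ring
      · have : f i = 0 := by simp [f, trunc_apply, hi]
        simp [this]
    rw [h1, one_mul]
    refine (hg2 ζ).trans (hΦ.mono fun i => ?_)
    rw [hζ]
    split_ifs
    · rw [abs_mul, abs_abs]
      refine mul_le_of_le_one_left (abs_nonneg _) ?_
      rcases lt_trichotomy (f i) 0 with h | h | h <;> simp [h]
    · simp
  have h1 : g η = Φ η := by
    refine (hg1 ⟨η, Submodule.mem_span_singleton_self η⟩).trans ?_
    exact LinearPMap.mkSpanSingleton_apply ℝ _ hη _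
  have h2 : g η = ∑ i ∈ Finset.range N, f i * η i := by
    conv_lhs => rw [← Finsupp.sum_single η]
    rw [Finsupp.sum, map_sum]
    rw [Finset.sum_subset hN]
    · refine Finset.sum_congr rfl fun i hi => ?_
      have : Finsupp.single i (η i) = (η i) • Finsupp.single i (1 : ℝ) := by simp
      rw [this, map_smul, smul_eq_mul, mul_comm]
      simp [f, trunc_apply, Finset.mem_range.1 hi]
    · intro i _ hi
      rw [Finsupp.notMem_support_iff.1 hi]
      simp
  calc Φ η = ∑ i ∈ Finset.range N, f i * η i := by rw [← h1, h2]
    _ ≤ ∑ i ∈ Finset.range N, |η i| * |f i| := by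
        refine Finset.sum_le_sum fun i _ => ?_
        rw [mul_comm, ← abs_mul]
        exact le_abs_self _
    _ ≤ adjointFn (adjointFn Φ) η * adjointFn Φ f :=
        sum_abs_mul_abs_le hA η f N
    _ ≤ _ := mul_le_of_le_one_right (adjointFn_nonneg hA _) hf

end Adjoint

end

section

/-! ### Singular numbers -/

open Filter Topology ContinuousLinearMap

section SNumbers

variable {E : Type*} [NormedAddCommGroup E] [InnerProductSpace ℂ E]
  {E' : Type*} [NormedAddCommGroup E'] [InnerProductSpace ℂ E']

theorem bddBelow_sNumber (x : E →L[ℂ] E) (k : ℕ) : BddBelow {r : ℝ | ∃ F : E →L[ℂ] E,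
    LinearMap.rank (F : E →ₗ[ℂ] E) ≤ (k : Cardinal) ∧ r = ‖x - F‖} :=
  ⟨0, by rintro r ⟨F, -, rfl⟩; exact norm_nonneg _⟩

theorem nonempty_sNumber (x : E →L[ℂ] E) (k : ℕ) : {r : ℝ | ∃ F : E →L[ℂ] E,
    LinearMap.rank (F : E →ₗ[ℂ] E) ≤ (k : Cardinal) ∧ r = ‖x - F‖}.Nonempty :=
  ⟨_, 0, by simp, rfl⟩

theorem sNumber_nonneg (x : E →L[ℂ] E) (k : ℕ) : 0 ≤ sNumber x k :=
  Real.sInf_nonneg (by rintro r ⟨F, -, rfl⟩; exact norm_nonneg _)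

theorem sNumber_le {x F : E →L[ℂ] E} {k : ℕ}
    (hF : LinearMap.rank (F : E →ₗ[ℂ] E) ≤ (k : Cardinal)) : sNumber x k ≤ ‖x - F‖ :=
  csInf_le (bddBelow_sNumber x k) ⟨F, hF, rfl⟩

theorem le_sNumber_of_forall {x : E →L[ℂ] E} {k : ℕ} {r : ℝ}
    (h : ∀ F : E →L[ℂ] E, LinearMap.rank (F : E →ₗ[ℂ] E) ≤ (k : Cardinal) → r ≤ ‖x - F‖) :
    r ≤ sNumber x k :=
  le_csInf (nonempty_sNumber x k) (by rintro _ ⟨F, hF, rfl⟩; exact h F hF)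

theorem sNumber_zero_right (x : E →L[ℂ] E) : sNumber x 0 = ‖x‖ := by
  refine le_antisymm ?_ (le_sNumber_of_forall fun F hF => ?_)
  · simpa using sNumber_le (x := x) (F := 0) (k := 0) (by simp)
  · have : (F : E →ₗ[ℂ] E) = 0 := by
      rw [Nat.cast_zero, nonpos_iff_eq_zero, LinearMap.rank, Submodule.rank_eq_zero] at hF
      exact LinearMap.range_eq_bot.1 hF
    rw [show F = 0 from ContinuousLinearMap.coe_injective this, sub_zero]

theorem sNumber_comp_le (C : E →L[ℂ] E') (x : E →L[ℂ] E) (D : E' →L[ℂ] E) (k : ℕ) :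
    sNumber (C ∘L x ∘L D) k ≤ ‖C‖ * ‖D‖ * sNumber x k := by
  have key : ∀ F : E →L[ℂ] E, LinearMap.rank (F : E →ₗ[ℂ] E) ≤ (k : Cardinal) →
      sNumber (C ∘L x ∘L D) k ≤ ‖C‖ * ‖D‖ * ‖x - F‖ := by
    intro F hF
    have h1 : LinearMap.rank ((C ∘L F ∘L D : E' →L[ℂ] E') : E' →ₗ[ℂ] E') ≤ (k : Cardinal) := by
      have h2 := LinearMap.lift_rank_comp_le_right
        ((F ∘L D : E' →L[ℂ] E) : E' →ₗ[ℂ] E) (C : E →ₗ[ℂ] E')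
      have h3 := Cardinal.lift_le_nat_iff.2
        ((LinearMap.rank_comp_le_left (D : E' →ₗ[ℂ] E) (F : E →ₗ[ℂ] E)).trans hF)
      exact Cardinal.lift_le_nat_iff.1 (h2.trans h3)
    refine (sNumber_le h1).trans ?_
    have h2 : C ∘L x ∘L D - C ∘L F ∘L D = C ∘L (x - F) ∘L D := by ext v; simp
    rw [h2]
    calc ‖C ∘L (x - F) ∘L D‖ ≤ ‖C‖ * (‖x - F‖ * ‖D‖) :=
          (opNorm_comp_le _ _).trans
            (mul_le_mul_of_nonneg_left (opNorm_comp_le _ _) (norm_nonneg _))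
      _ = _ := by ring
  rcases (mul_nonneg (norm_nonneg C) (norm_nonneg D)).eq_or_lt with h0 | h0
  · have := key 0 (by simp)
    rw [← h0, zero_mul] at this ⊢
    exact this
  · rw [← div_le_iff₀' h0]
    exact le_sNumber_of_forall fun F hF => (div_le_iff₀' h0).2 (key F hF)

/-- One half of the min–max principle: an operator of rank at most `k` kills a nonzero vector of
`V`, and there `x - F` agrees with `x`. -/
theorem le_sNumber {x : E →L[ℂ] E} {k : ℕ} {r : ℝ} (V : Submodule ℂ E)
    (hV : k < Module.finrank ℂ V) (h : ∀ v ∈ V, r * ‖v‖ ≤ ‖x v‖) : r ≤ sNumber x k := by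
  refine le_sNumber_of_forall fun F hF => ?_
  have hVf : FiniteDimensional ℂ V := Module.finite_of_finrank_pos (by omega)
  have hRf : Module.Finite ℂ (LinearMap.range (F : E →ₗ[ℂ] E)) :=
    Module.rank_lt_aleph0_iff.1 (hF.trans_lt (Cardinal.natCast_lt_aleph0))
  have hk : Module.finrank ℂ (LinearMap.range (F : E →ₗ[ℂ] E)) < Module.finrank ℂ V :=
    (Module.finrank_le_of_rank_le hF).trans_lt hV
  obtain ⟨v, hv, hv0⟩ := Submodule.exists_mem_ne_zero_of_ne_bot
    (LinearMap.ker_ne_bot_of_finrank_lt (f := (F : E →ₗ[ℂ] E).rangeRestrict ∘ₗ V.subtype) hk)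
  have hFv : F (v : E) = 0 := by
    have := congrArg Subtype.val (LinearMap.mem_ker.1 hv)
    simpa using this
  have hpos : 0 < ‖(v : E)‖ := norm_pos_iff.2 (by simpa using hv0)
  refine le_of_mul_le_mul_right ((h v v.2).trans ?_) hpos
  calc ‖x v‖ = ‖(x - F) v‖ := by simp [hFv]
    _ ≤ _ := le_opNorm _ _

theorem exists_finrank_eq_of_lt_rank {K : Submodule ℂ E} {k : ℕ}
    (h : (k : Cardinal) < Module.rank ℂ K) :
    ∃ V : Submodule ℂ E, V ≤ K ∧ Module.finrank ℂ V = k + 1 := by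
  have h' : ((k + 1 : ℕ) : Cardinal) ≤ Module.rank ℂ K := by
    rw [Nat.cast_succ, ← Cardinal.succ_natCast]
    exact Order.succ_le_of_lt h
  obtain ⟨s, hs, hli⟩ := le_rank_iff_exists_linearIndependent_finset.1 h'
  refine ⟨(Submodule.span ℂ (s : Set K)).map K.subtype, Submodule.map_subtype_le _ _, ?_⟩
  rw [Submodule.finrank_map_subtype_eq, finrank_span_finset_eq_card hli, hs]

variable [CompleteSpace E]

/-- A spectral subspace of `x* x` for the interval `(r², ∞)`. -/
theorem exists_spectral_subspace (x : E →L[ℂ] E) {r : ℝ} (hr : 0 ≤ r) :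
    ∃ K : Submodule ℂ E, (∀ v ∈ K, r * ‖v‖ ≤ ‖x v‖) ∧
      ∀ k : ℕ, Module.rank ℂ K ≤ (k : Cardinal) →
        sNumber x k ≤ r ∧ sNumber (star x * x) k ≤ r ^ 2 := by
  -- The range of the positive part of `D` replaces the range of a spectral projection: on it `D` is
  -- nonnegative, and on the kernel of `D⁺` one has `D = -D⁻ ≤ 0`. Since `⟨D v, v⟩ = ‖x v‖² - r²
  -- ‖v‖²`, this compares `‖x v‖` with `r ‖v‖`.
  set D : E →L[ℂ] E := star x * x - ((r ^ 2 : ℝ) : ℂ) • 1 with hD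
  have hsa : IsSelfAdjoint D := by
    refine (IsSelfAdjoint.star_mul_self x).sub ?_
    rw [isSelfAdjoint_iff, star_smul, star_one]
    simp
  have hDv : ∀ v, RCLike.re (inner ℂ (D v) v) = ‖x v‖ ^ 2 - r ^ 2 * ‖v‖ ^ 2 := by
    intro v
    have : D v = (adjoint x) (x v) - ((r ^ 2 : ℝ) : ℂ) • v := rfl
    rw [this, inner_sub_left, adjoint_inner_left, inner_smul_left, map_sub,
      inner_self_eq_norm_sq, Complex.conj_ofReal]
    rw [← inner_self_eq_norm_sq (𝕜 := ℂ) v]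
    exact congrArg _ (RCLike.re_ofReal_mul (K := ℂ) (r ^ 2) _)
  have hsub : D⁺ - D⁻ = D := CFC.posPart_sub_negPart D hsa
  have hpn : D⁺ * D⁻ = 0 := CFC.posPart_mul_negPart D
  have hnp : D⁻ * D⁺ = 0 := CFC.negPart_mul_posPart D
  have hpos := (nonneg_iff_isPositive _).1 (CFC.posPart_nonneg D)
  have hneg := (nonneg_iff_isPositive _).1 (CFC.negPart_nonneg D)
  have hcomm : D⁺ * D = D * D⁺ := by
    have h1 : D⁺ * D = D⁺ * (D⁺ - D⁻) := by rw [hsub]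
    have h2 : D * D⁺ = (D⁺ - D⁻) * D⁺ := by rw [hsub]
    rw [h1, h2, mul_sub, sub_mul, hpn, hnp]
  -- Consequently `x* x` preserves the kernel of `D⁺`; the estimate for `x* x` depends on this.
  have hcommA : D⁺ * (star x * x) = (star x * x) * D⁺ := by
    have : star x * x = D + ((r ^ 2 : ℝ) : ℂ) • 1 := by rw [hD]; abel
    rw [this, mul_add, add_mul, hcomm]
    simp
  have hker : ∀ w, D⁺ w = 0 → ‖x w‖ ≤ r * ‖w‖ := by
    intro w hw
    have h1 : D w = - D⁻ w := by
      conv_lhs => rw [← hsub]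
      simp [hw]
    have h2 := hDv w
    rw [h1, inner_neg_left, map_neg] at h2
    have h3 := hneg.re_inner_nonneg_left w
    refine le_of_sq_le_sq ?_ (by positivity)
    rw [mul_pow]
    linarith
  refine ⟨LinearMap.range (D⁺ : E →L[ℂ] E).toLinearMap, ?_, fun k hk => ?_⟩
  · rintro _ ⟨u, rfl⟩
    set v := D⁺ u with hv
    have h1 : D v = D⁺ v := by
      conv_lhs => rw [← hsub]
      have : D⁻ v = (D⁻ * D⁺) u := rfl
      simp [this, hnp]
    have h2 := hDv v
    rw [h1] at h2
    have h3 := hpos.re_inner_nonneg_left v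
    refine le_of_sq_le_sq ?_ (norm_nonneg _)
    rw [mul_pow]
    change r ^ 2 * ‖v‖ ^ 2 ≤ ‖x v‖ ^ 2
    linarith
  · set K := LinearMap.range (D⁺ : E →L[ℂ] E).toLinearMap with hK
    have hfin : FiniteDimensional ℂ K :=
      Module.rank_lt_aleph0_iff.1 (hk.trans_lt Cardinal.natCast_lt_aleph0)
    -- When `K` has finite dimension, `K` and its orthogonal complement split the space, and the
    -- complement lies in the kernel of `D⁺` because `D⁺` is symmetric.
    have horth : ∀ v, D⁺ (v - K.starProjection v) = 0 := by
      intro v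
      have hmem : v - K.starProjection v ∈ Kᗮ := K.sub_starProjection_mem_orthogonal v
      rw [← inner_self_eq_zero (𝕜 := ℂ)]
      have h1 := hpos.inner_left_eq_inner_right (v - K.starProjection v)
        (D⁺ (v - K.starProjection v))
      rw [h1]
      exact Submodule.inner_left_of_mem_orthogonal (LinearMap.mem_range_self _ _) hmem
    have hle : ∀ v, ‖v - K.starProjection v‖ ≤ ‖v‖ := by
      intro v
      rw [← Submodule.starProjection_orthogonal_val]
      exact Submodule.norm_starProjection_apply_le _ _
    have hrank : ∀ y : E →L[ℂ] E,
        LinearMap.rank ((y * K.starProjection : E →L[ℂ] E) : E →ₗ[ℂ] E) ≤ (k : Cardinal) := by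
      intro y
      refine le_trans (LinearMap.rank_comp_le_right _ (y : E →ₗ[ℂ] E)) ?_
      refine le_trans (Submodule.rank_mono ?_) hk
      rintro _ ⟨v, rfl⟩
      exact K.starProjection_apply_mem v
    constructor
    · refine (sNumber_le (hrank x)).trans (opNorm_le_bound _ hr fun v => ?_)
      have : (x - x * K.starProjection) v = x (v - K.starProjection v) := by simp
      rw [this]
      exact (hker _ (horth v)).trans (mul_le_mul_of_nonneg_left (hle v) hr)
    · refine (sNumber_le (hrank (star x * x))).trans
        (opNorm_le_bound _ (sq_nonneg r) fun v => ?_)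
      set w := v - K.starProjection v with hw
      have : (star x * x - star x * x * K.starProjection) v = (star x * x) w := by simp [hw]
      rw [this]
      set z := (star x * x) w with hz
      have hzk : D⁺ z = 0 := by
        have : D⁺ z = (D⁺ * (star x * x)) w := rfl
        rw [this, hcommA]
        have : ((star x * x) * D⁺) w = (star x * x) (D⁺ w) := rfl
        rw [this, horth v, map_zero]
      -- Both `w` and `z = x* x w` lie in the kernel of `D⁺`, so `‖z‖² = ⟨x w, x z⟩` is at most `r
      -- ‖w‖ · r ‖z‖`.
      have h1 : ‖z‖ ^ 2 ≤ ‖x w‖ * ‖x z‖ := by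
        rw [← inner_self_eq_norm_sq (𝕜 := ℂ)]
        have : inner ℂ z z = inner ℂ (x w) (x z) := by
          conv_lhs => rw [hz]
          exact adjoint_inner_left x z (x w)
        rw [this]
        exact re_inner_le_norm _ _
      have h2 : ‖z‖ ^ 2 ≤ (r ^ 2 * ‖w‖) * ‖z‖ := by
        refine h1.trans ((mul_le_mul (hker w (horth v)) (hker z hzk) (norm_nonneg _)
          (by positivity)).trans_eq (by ring))
      have h3 : ‖z‖ ≤ r ^ 2 * ‖w‖ := by
        rcases (norm_nonneg z).eq_or_lt with h0 | h0
        · rw [← h0]; positivity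
        · rw [sq ‖z‖] at h2
          exact le_of_mul_le_mul_right h2 h0
      exact h3.trans (mul_le_mul_of_nonneg_left (hle v) (sq_nonneg r))

/-- The other half of the min–max principle. Nothing is compact here, so the bound need not be
attained and the strict inequality is the natural hypothesis. -/
theorem exists_of_lt_sNumber {x : E →L[ℂ] E} {k : ℕ} {r : ℝ} (hr : 0 ≤ r)
    (h : r < sNumber x k) :
    ∃ V : Submodule ℂ E, Module.finrank ℂ V = k + 1 ∧ ∀ v ∈ V, r * ‖v‖ ≤ ‖x v‖ := by
  obtain ⟨K, hK, hk⟩ := exists_spectral_subspace x hr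
  have : (k : Cardinal) < Module.rank ℂ K := by
    by_contra! hle
    exact absurd (hk k hle).1 (not_le.2 h)
  obtain ⟨V, hVK, hV⟩ := exists_finrank_eq_of_lt_rank this
  exact ⟨V, hV, fun v hv => hK v (hVK hv)⟩

/-- For `r` above `s_k(x)` the spectral subspace has rank at most `k` and bounds `s_k(x* x)` by
`r²`; for `r` below, a subspace of dimension `k + 1` bounds it from below. Letting `r` tend to
`s_k(x)` from either side gives equality. -/
theorem sNumber_star_mul_self (x : E →L[ℂ] E) (k : ℕ) :
    sNumber (star x * x) k = sNumber x k ^ 2 := by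
  refine le_antisymm ?_ ?_
  · have key : ∀ r, sNumber x k < r → sNumber (star x * x) k ≤ r ^ 2 := by
      intro r hr
      have hr0 : 0 ≤ r := (sNumber_nonneg x k).trans hr.le
      obtain ⟨K, hK, hk⟩ := exists_spectral_subspace x hr0
      refine (hk k ?_).2
      by_contra! hlt
      obtain ⟨V, hVK, hV⟩ := exists_finrank_eq_of_lt_rank hlt
      exact absurd (le_sNumber V (by omega) fun v hv => hK v (hVK hv)) (not_le.2 hr)
    have ht : Tendsto (fun r : ℝ => r ^ 2) (𝓝[>] sNumber x k) (𝓝 (sNumber x k ^ 2)) :=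
      ((continuous_pow 2).tendsto _).mono_left nhdsWithin_le_nhds
    exact ge_of_tendsto ht (eventually_nhdsWithin_of_forall key)
  · have key : ∀ r, 0 ≤ r → r < sNumber x k → r ^ 2 ≤ sNumber (star x * x) k := by
      intro r hr0 hr
      obtain ⟨V, hV, h⟩ := exists_of_lt_sNumber hr0 hr
      refine le_sNumber V (by omega) fun v hv => ?_
      rcases (norm_nonneg v).eq_or_lt with h0 | h0
      · rw [← h0, mul_zero]; exact norm_nonneg _
      · refine le_of_mul_le_mul_right ?_ h0
        calc r ^ 2 * ‖v‖ * ‖v‖ = (r * ‖v‖) ^ 2 := by ring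
          _ ≤ ‖x v‖ ^ 2 := pow_le_pow_left₀ (by positivity) (h v hv) 2
          _ = RCLike.re (inner ℂ ((star x * x) v) v) := by
            rw [← inner_self_eq_norm_sq (𝕜 := ℂ)]
            congr 1
            exact (adjoint_inner_left x v (x v)).symm
          _ ≤ _ := re_inner_le_norm _ _
    rcases (sNumber_nonneg x k).eq_or_lt with h0 | h0
    · rw [← h0]; simpa using sNumber_nonneg _ _
    have ht : Tendsto (fun r : ℝ => r ^ 2) (𝓝[<] sNumber x k) (𝓝 (sNumber x k ^ 2)) :=
      ((continuous_pow 2).tendsto _).mono_left nhdsWithin_le_nhds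
    refine le_of_tendsto ht ?_
    filter_upwards [Ioo_mem_nhdsLT h0] with r hr
    exact key r hr.1.le hr.2

/-- Lower semicontinuity of the singular numbers for strong convergence: a lower bound for `x` is
witnessed on a finite-dimensional subspace, and there strong convergence is uniform. -/
theorem eventually_le_sNumber {ι : Type*} {l : Filter ι} {y : ι → E →L[ℂ] E} {x : E →L[ℂ] E}
    (hy : ∀ v, Tendsto (fun i => y i v) l (𝓝 (x v))) {k : ℕ} {r : ℝ} (hr : 0 ≤ r)
    (h : r < sNumber x k) : ∀ᶠ i in l, r ≤ sNumber (y i) k := by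
  obtain ⟨r', h1, h2⟩ := exists_between h
  obtain ⟨V, hV, hVx⟩ := exists_of_lt_sNumber (hr.trans h1.le) h2
  have hVf : FiniteDimensional ℂ V := Module.finite_of_finrank_pos (by omega)
  let b := stdOrthonormalBasis ℂ V
  have ht : Tendsto (fun i => ∑ j, ‖y i (b j) - x (b j)‖) l (𝓝 0) := by
    have := tendsto_finsetSum (Finset.univ) fun j _ =>
      ((hy (b j)).sub_const (x (b j))).norm
    simpa using this
  filter_upwards [ht.eventually (gt_mem_nhds (sub_pos.2 h1))] with i hi
  refine le_sNumber V (by omega) fun v hv => ?_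
  have hsum : v = ∑ j, (inner ℂ (b j) ⟨v, hv⟩ : ℂ) • (b j : E) := by
    have := congrArg Subtype.val (b.sum_repr' ⟨v, hv⟩)
    simpa using this.symm
  have hd : ‖(y i - x) v‖ ≤ (r' - r) * ‖v‖ := by
    calc ‖(y i - x) v‖ = ‖∑ j, (inner ℂ (b j) ⟨v, hv⟩ : ℂ) • (y i - x) (b j)‖ := by
          conv_lhs => rw [hsum]
          simp only [map_sum, map_smul]
      _ ≤ ∑ j, ‖v‖ * ‖y i (b j) - x (b j)‖ := by
          refine norm_sum_le_of_le _ fun j _ => ?_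
          rw [norm_smul]
          refine mul_le_mul_of_nonneg_right ?_ (norm_nonneg _)
          refine (norm_inner_le_norm _ _).trans ?_
          rw [b.norm_eq_one, one_mul]
          rfl
      _ = (∑ j, ‖y i (b j) - x (b j)‖) * ‖v‖ := by rw [← Finset.mul_sum, mul_comm]
      _ ≤ _ := mul_le_mul_of_nonneg_right hi.le (norm_nonneg _)
  have h3 := hVx v hv
  have h4 : ‖x v‖ ≤ ‖y i v‖ + ‖(y i - x) v‖ := by
    have : x v = y i v - (y i - x) v := by simp
    conv_lhs => rw [this]
    exact norm_sub_le _ _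
  linarith

end SNumbers

end

section

/-! ### The norms `‖·‖_Φ` -/

open Filter Topology ContinuousLinearMap

section IdealNorm

variable {E : Type*} [NormedAddCommGroup E] [InnerProductSpace ℂ E]
  {E' : Type*} [NormedAddCommGroup E'] [InnerProductSpace ℂ E']
  {Φ Ψ : (ℕ →₀ ℝ) → ℝ}

theorem idealNorm_mono_fn (hle : ∀ ξ, Ψ ξ ≤ Φ ξ) (x : E →L[ℂ] E) :
    idealNorm Ψ x ≤ idealNorm Φ x :=
  iSup_mono fun _ => ENNReal.ofReal_le_ofReal (hle _)

theorem idealNorm_le_of_sNumber_le (hΦ : IsSNFunction Φ) {x : E →L[ℂ] E} {y : E' →L[ℂ] E'}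
    {c : ℝ} (hc : 0 ≤ c) (h : ∀ k, sNumber x k ≤ c * sNumber y k) :
    idealNorm Φ x ≤ ENNReal.ofReal c * idealNorm Φ y := by
  refine iSup_le fun n => ?_
  have h1 : Φ (trunc (sNumber x) n) ≤ c * Φ (trunc (sNumber y) n) := by
    rw [← abs_of_nonneg hc, ← hΦ.trunc_smul]
    refine hΦ.trunc_mono_left n fun i _ => ?_
    rw [abs_of_nonneg (sNumber_nonneg x i)]
    exact (h i).trans (le_abs_self _)
  refine (ENNReal.ofReal_le_ofReal h1).trans ?_
  rw [ENNReal.ofReal_mul hc]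
  gcongr
  exact le_iSup (fun n => ENNReal.ofReal (Φ (trunc (sNumber y) n))) n

theorem idealNorm_comp_le (hΦ : IsSNFunction Φ) (C : E →L[ℂ] E') (x : E →L[ℂ] E)
    (D : E' →L[ℂ] E) :
    idealNorm Φ (C ∘L x ∘L D) ≤ ENNReal.ofReal (‖C‖ * ‖D‖) * idealNorm Φ x :=
  idealNorm_le_of_sNumber_le hΦ (by positivity) fun k => sNumber_comp_le C x D k

theorem idealNorm_comp_le_of_norm_le_one (hΦ : IsSNFunction Φ) {C : E →L[ℂ] E'} (x : E →L[ℂ] E)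
    {D : E' →L[ℂ] E} (hC : ‖C‖ ≤ 1) (hD : ‖D‖ ≤ 1) :
    idealNorm Φ (C ∘L x ∘L D) ≤ idealNorm Φ x := by
  refine (idealNorm_comp_le hΦ C x D).trans (mul_le_of_le_one_left (by simp) ?_)
  rw [ENNReal.ofReal_le_one]
  exact mul_le_one₀ hC (norm_nonneg _) hD

theorem ofReal_norm_le_idealNorm (hΦ : IsSNFunction Φ) (x : E →L[ℂ] E) :
    ENNReal.ofReal ‖x‖ ≤ idealNorm Φ x := by
  refine le_trans (ENNReal.ofReal_le_ofReal ?_)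
    (le_iSup (fun n => ENNReal.ofReal (Φ (trunc (sNumber x) n))) 1)
  refine le_trans ?_ (hΦ.abs_apply_le _ 0)
  rw [trunc_apply, if_pos one_pos, sNumber_zero_right]
  exact le_abs_self _

theorem idealNorm_zero (hΦ : IsSNFunction Φ) : idealNorm Φ (0 : E →L[ℂ] E) = 0 := by
  have := idealNorm_comp_le hΦ (0 : E →L[ℂ] E) (0 : E →L[ℂ] E) (0 : E →L[ℂ] E)
  simpa using this

theorem idealNorm_eq_zero (hΦ : IsSNFunction Φ) {x : E →L[ℂ] E} :
    idealNorm Φ x = 0 ↔ x = 0 := by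
  refine ⟨fun h => ?_, fun h => h ▸ idealNorm_zero hΦ⟩
  have := ofReal_norm_le_idealNorm hΦ x
  rw [h, nonpos_iff_eq_zero, ENNReal.ofReal_eq_zero] at this
  simpa using this

theorem idealNorm_eq_of_sNumber_eq_zero (hΦ : IsSNFunction Φ) {x : E →L[ℂ] E} {N : ℕ}
    (h : ∀ k, N ≤ k → sNumber x k = 0) :
    idealNorm Φ x = ENNReal.ofReal (Φ (trunc (sNumber x) N)) := by
  refine le_antisymm (iSup_le fun n => ENNReal.ofReal_le_ofReal (hΦ.mono fun i => ?_))
    (le_iSup (fun n => ENNReal.ofReal (Φ (trunc (sNumber x) n))) N)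
  simp only [trunc_apply]
  split_ifs with h1 h2
  · rfl
  · simp [h i (by omega)]
  all_goals simp

theorem sNumber_eq_zero_of_rank_le {x : E →L[ℂ] E} {N : ℕ}
    (h : LinearMap.rank (x : E →ₗ[ℂ] E) ≤ (N : Cardinal)) {k : ℕ} (hk : N ≤ k) :
    sNumber x k = 0 := by
  refine le_antisymm ?_ (sNumber_nonneg x k)
  simpa using sNumber_le (x := x) (F := x) (k := k) (h.trans (by exact_mod_cast hk))

theorem idealNorm_lt_top_of_rank_le (hΦ : IsSNFunction Φ) {x : E →L[ℂ] E} {N : ℕ}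
    (h : LinearMap.rank (x : E →ₗ[ℂ] E) ≤ (N : Cardinal)) : idealNorm Φ x < ∞ := by
  rw [idealNorm_eq_of_sNumber_eq_zero hΦ fun k hk => sNumber_eq_zero_of_rank_le h hk]
  exact ENNReal.ofReal_lt_top

theorem idealNorm_le_of_tendsto [CompleteSpace E] (hΦ : IsSNFunction Φ) {ι : Type*}
    {l : Filter ι} [l.NeBot]
    {y : ι → E →L[ℂ] E} {x : E →L[ℂ] E} (hy : ∀ v, Tendsto (fun i => y i v) l (𝓝 (x v)))
    {c : ℝ≥0∞} (h : ∀ i, idealNorm Φ (y i) ≤ c) : idealNorm Φ x ≤ c := by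
  refine iSup_le fun n => ?_
  set a := Φ (trunc (sNumber x) n)
  -- The factor `θ < 1` leaves room below each nonzero singular number, so finitely many of them are
  -- controlled at once; afterwards `θ → 1`.
  have key : ∀ θ ∈ Set.Ioo (0 : ℝ) 1, ENNReal.ofReal (θ * a) ≤ c := by
    intro θ hθ
    have h1 : ∀ k ∈ Finset.range n, ∀ᶠ i in l, θ * sNumber x k ≤ sNumber (y i) k := by
      intro k _
      rcases (sNumber_nonneg x k).eq_or_lt with h0 | h0
      · refine Eventually.of_forall fun i => ?_
        rw [← h0, mul_zero]
        exact sNumber_nonneg _ _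
      · exact eventually_le_sNumber hy (mul_nonneg hθ.1.le h0.le)
          (mul_lt_of_lt_one_left h0 hθ.2)
    obtain ⟨i, hi⟩ := ((Finset.eventually_all _).2 h1).exists
    refine le_trans ?_ (h i)
    refine le_trans (ENNReal.ofReal_le_ofReal ?_)
      (le_iSup (fun n => ENNReal.ofReal (Φ (trunc (sNumber (y i)) n))) n)
    rw [← abs_of_pos hθ.1, ← hΦ.trunc_smul]
    refine hΦ.trunc_mono_left n fun k hk => ?_
    rw [abs_of_nonneg (mul_nonneg hθ.1.le (sNumber_nonneg x k))]
    exact (hi k (Finset.mem_range.2 hk)).trans (le_abs_self _)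
  have ht : Tendsto (fun θ : ℝ => ENNReal.ofReal (θ * a)) (𝓝[<] 1) (𝓝 (ENNReal.ofReal a)) := by
    have h2 : Tendsto (fun θ : ℝ => θ * a) (𝓝[<] 1) (𝓝 (1 * a)) :=
      ((continuous_mul_const a).tendsto 1).mono_left nhdsWithin_le_nhds
    rw [one_mul] at h2
    exact ENNReal.tendsto_ofReal h2
  refine le_of_tendsto ht ?_
  filter_upwards [Ioo_mem_nhdsLT (zero_lt_one' ℝ)] with θ hθ using key θ hθ

theorem idealNorm_twoConvex [CompleteSpace E] (hΨ : IsSNFunction Ψ) (x : E →L[ℂ] E) :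
    idealNorm (twoConvex Ψ) x = idealNorm Ψ (star x * x) ^ (1 / 2 : ℝ) := by
  have h := (ENNReal.orderIsoRpow (1 / 2) (by norm_num)).map_iSup
    fun n => ENNReal.ofReal (Ψ (trunc (sNumber (star x * x)) n))
  simp only [ENNReal.orderIsoRpow_apply] at h
  rw [idealNorm, idealNorm, h]
  refine iSup_congr fun n => ?_
  rw [ENNReal.ofReal_rpow_of_nonneg (hΨ.nonneg _) (by norm_num), ← Real.sqrt_eq_rpow, twoConvex]
  congr 3
  ext i
  simp only [Finsupp.mapRange_apply, trunc_apply]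
  split_ifs
  · rw [sNumber_star_mul_self]
  · simp

theorem isCompactOperator_of_finrank_range {F : E →L[ℂ] E}
    [FiniteDimensional ℂ (LinearMap.range (F : E →ₗ[ℂ] E))] : IsCompactOperator F := by
  have : ProperSpace (LinearMap.range (F : E →ₗ[ℂ] E)) := FiniteDimensional.proper ℂ _
  refine ⟨Subtype.val '' Metric.closedBall (0 : LinearMap.range (F : E →ₗ[ℂ] E)) 1,
    (isCompact_closedBall _ _).image continuous_subtype_val, ?_⟩
  have h : Metric.closedBall (0 : E) 1 ∈ 𝓝 (F 0) := by
    rw [map_zero]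
    exact Metric.closedBall_mem_nhds _ one_pos
  filter_upwards [F.continuous.continuousAt h] with v hv
  refine ⟨⟨F v, LinearMap.mem_range_self _ v⟩, ?_, rfl⟩
  simpa using hv

/-- If all `s_k(x) ≥ ε`, then a sequence with sup norm `B` is dominated by `B / ε` times the
singular numbers of `x`, so its norm is at most `B ‖x‖ / ε` and the norming function is equivalent
to the sup norm. Otherwise `s_k(x)` comes arbitrarily close to zero, and `x` is a norm limit of
finite rank operators. -/
theorem isCompactOperator_of_idealNorm_twoConvex [CompleteSpace E] (hΨ : IsSNFunction Ψ)
    (hs : ¬ SupEquivalent (twoConvex Ψ)) {x : E →L[ℂ] E}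
    (hx : idealNorm (twoConvex Ψ) x < ∞) : IsCompactOperator x := by
  have hinf : ∀ ε : ℝ, 0 < ε → ∃ k, sNumber x k < ε := by
    intro ε hε
    by_contra! hge
    apply hs
    set M := (idealNorm (twoConvex Ψ) x).toReal with hM
    have h1 : ∀ n, twoConvex Ψ (trunc (sNumber x) n) ≤ M := by
      intro n
      rw [hM, ← ENNReal.ofReal_le_iff_le_toReal hx.ne]
      exact le_iSup (fun n => ENNReal.ofReal (twoConvex Ψ (trunc (sNumber x) n))) n
    refine ⟨M / ε, fun ξ => ?_⟩
    obtain ⟨n, hn⟩ := exists_support_subset_range ξ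
    have hbdd : BddAbove (Set.range fun i => |ξ i|) := by
      refine ⟨∑ i ∈ ξ.support, |ξ i|, ?_⟩
      rintro _ ⟨i, rfl⟩
      by_cases hi : i ∈ ξ.support
      · exact Finset.single_le_sum (f := fun i => |ξ i|) (fun j _ => abs_nonneg _) hi
      · simp only [Finsupp.notMem_support_iff.1 hi, abs_zero]
        exact Finset.sum_nonneg fun j _ => abs_nonneg _
    set B := ⨆ i, |ξ i| with hB
    have hB0 : 0 ≤ B := Real.iSup_nonneg fun i => abs_nonneg _
    have h2 : twoConvex Ψ ξ ≤ B / ε * twoConvex Ψ (trunc (sNumber x) n) := by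
      unfold twoConvex
      rw [← Real.sqrt_sq (div_nonneg hB0 hε.le), ← Real.sqrt_mul (sq_nonneg _)]
      refine Real.sqrt_le_sqrt ?_
      rw [← abs_of_nonneg (sq_nonneg (B / ε)), ← hΨ.smul]
      refine hΨ.mono fun i => ?_
      by_cases hi : i < n
      · simp only [Finsupp.mapRange_apply, Finsupp.smul_apply, trunc_apply, if_pos hi, smul_eq_mul]
        rw [← mul_pow, abs_pow, abs_pow]
        refine pow_le_pow_left₀ (abs_nonneg _) ?_ 2
        refine (le_ciSup hbdd i).trans ?_
        rw [abs_mul, abs_of_nonneg (div_nonneg hB0 hε.le), abs_of_nonneg (sNumber_nonneg x i)]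
        rw [div_mul_eq_mul_div, le_div_iff₀ hε]
        exact mul_le_mul_of_nonneg_left (hge i) hB0
      · have : ξ i = 0 := by
          by_contra h
          exact hi (Finset.mem_range.1 (hn n le_rfl (Finsupp.mem_support_iff.2 h)))
        simp only [Finsupp.mapRange_apply, this]
        simp
        positivity
    refine h2.trans ((mul_le_mul_of_nonneg_left (h1 n) (div_nonneg hB0 hε.le)).trans_eq ?_)
    ring
  have hF : ∀ n : ℕ, ∃ F : E →L[ℂ] E, IsCompactOperator F ∧ ‖x - F‖ < 1 / ((n : ℝ) + 1) := by
    intro n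
    obtain ⟨k, hk⟩ := hinf (1 / ((n : ℝ) + 1)) (by positivity)
    obtain ⟨_, ⟨F, hF, rfl⟩, hlt⟩ := exists_lt_of_csInf_lt (nonempty_sNumber x k) hk
    have hRf : Module.Finite ℂ (LinearMap.range (F : E →ₗ[ℂ] E)) :=
      Module.rank_lt_aleph0_iff.1 (hF.trans_lt Cardinal.natCast_lt_aleph0)
    exact ⟨F, isCompactOperator_of_finrank_range, hlt⟩
  choose F hFc hFx using hF
  refine isCompactOperator_of_tendsto (l := atTop) (F := F) ?_ (Eventually.of_forall hFc)
  rw [tendsto_iff_norm_sub_tendsto_zero]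
  refine squeeze_zero (fun _ => norm_nonneg _) (fun n => ?_)
    tendsto_one_div_add_atTop_nhds_zero_nat
  rw [norm_sub_rev]
  exact (hFx n).le

end IdealNorm

end

section

/-! ### Matrices -/

open Filter Topology ContinuousLinearMap

section Synth

variable {E : Type*} [NormedAddCommGroup E] [InnerProductSpace ℂ E] {ι : Type*} [Fintype ι]

/-- The operator `ℂ^ι → E` sending the unit vectors to the vectors `f i`. -/
def synth (f : ι → E) : EuclideanSpace ℂ ι →L[ℂ] E :=
  ∑ i, (EuclideanSpace.proj i : EuclideanSpace ℂ ι →L[ℂ] ℂ).smulRight (f i)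

theorem synth_apply (f : ι → E) (v : EuclideanSpace ℂ ι) : synth f v = ∑ i, v i • f i := by
  simp [synth]

theorem synth_single [DecidableEq ι] (f : ι → E) (i : ι) :
    synth f (EuclideanSpace.single i 1) = f i := by
  rw [synth_apply, Finset.sum_eq_single i] <;> simp +contextual

variable [CompleteSpace E]

theorem adjoint_synth_apply (f : ι → E) (w : E) (i : ι) :
    (adjoint (synth f) w) i = inner ℂ (f i) w := by
  classical
  have h := adjoint_inner_right (synth f) (EuclideanSpace.single i (1 : ℂ)) w
  rw [synth_single, EuclideanSpace.inner_single_left] at h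
  simpa using h

/-- The bridge between operators and matrices: compressions, Gram matrices and the tensor
computations for `ρ_T` are all instances of this identity. -/
theorem adjoint_synth_comp_comp_synth [DecidableEq ι] (f g : ι → E) (B : E →L[ℂ] E) :
    adjoint (synth f) ∘L B ∘L synth g =
      Matrix.toEuclideanCLM (n := ι) (𝕜 := ℂ) (Matrix.of fun i j => inner ℂ (f i) (B (g j))) := by
  ext v i
  rw [Matrix.ofLp_toEuclideanCLM]
  rw [comp_apply, comp_apply, adjoint_synth_apply, synth_apply]
  simp only [map_sum, map_smul, inner_sum, inner_smul_right, Matrix.mulVec, dotProduct,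
    Matrix.of_apply]
  exact Finset.sum_congr rfl fun j _ => mul_comm _ _

theorem norm_synth_sq [DecidableEq ι] (f : ι → E) : ‖synth f‖ * ‖synth f‖ =
    ‖Matrix.toEuclideanCLM (n := ι) (𝕜 := ℂ) (Matrix.of fun i j => inner ℂ (f i) (f j))‖ := by
  rw [← norm_adjoint_comp_self]
  congr 1
  exact adjoint_synth_comp_comp_synth f f (ContinuousLinearMap.id ℂ E)

theorem norm_synth_le_one {f : ι → E} (hf : Orthonormal ℂ f) : ‖synth f‖ ≤ 1 := by
  classical
  have h : (Matrix.of fun i j => inner ℂ (f i) (f j)) = (1 : Matrix ι ι ℂ) := by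
    ext i j
    rw [Matrix.of_apply, orthonormal_iff_ite.1 hf, Matrix.one_apply]
  have h2 := norm_synth_sq f
  rw [h, map_one] at h2
  have h3 : ‖(1 : EuclideanSpace ℂ ι →L[ℂ] EuclideanSpace ℂ ι)‖ ≤ 1 := norm_id_le
  nlinarith [norm_nonneg (synth f)]

end Synth

/-! ### Norms of matrices over a finite index set -/

section MatNorm

variable {ι κ : Type*} [Fintype ι] [DecidableEq ι] [Fintype κ] [DecidableEq κ]
  {Φ Ψ : (ℕ →₀ ℝ) → ℝ}

/-- The norm `‖·‖_Φ` on matrices over a finite index set. -/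
def mNorm (Φ : (ℕ →₀ ℝ) → ℝ) (A : Matrix ι ι ℂ) : ℝ≥0∞ :=
  idealNorm Φ (Matrix.toEuclideanCLM (n := ι) (𝕜 := ℂ) A)

theorem toEuclideanCLM_single (A : Matrix ι ι ℂ) (i j : ι) :
    Matrix.toEuclideanCLM (n := ι) (𝕜 := ℂ) A (EuclideanSpace.single j 1) i = A i j := by
  rw [Matrix.ofLp_toEuclideanCLM]
  simp

theorem toEuclideanCLM_inner (X : EuclideanSpace ℂ ι →L[ℂ] EuclideanSpace ℂ ι) :
    Matrix.toEuclideanCLM (n := ι) (𝕜 := ℂ)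
      (Matrix.of fun i j => X (EuclideanSpace.single j 1) i) = X := by
  obtain ⟨A, rfl⟩ := EquivLike.surjective (Matrix.toEuclideanCLM (n := ι) (𝕜 := ℂ)) X
  refine congrArg _ (Matrix.ext fun i j => ?_)
  rw [Matrix.of_apply, toEuclideanCLM_single]

theorem mNorm_zero (hΦ : IsSNFunction Φ) : mNorm Φ (0 : Matrix ι ι ℂ) = 0 := by
  rw [mNorm, map_zero, idealNorm_zero hΦ]

theorem mNorm_eq_zero (hΦ : IsSNFunction Φ) {A : Matrix ι ι ℂ} : mNorm Φ A = 0 ↔ A = 0 := by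
  rw [mNorm, idealNorm_eq_zero hΦ]
  exact map_eq_zero_iff _ (EquivLike.injective (Matrix.toEuclideanCLM (n := ι) (𝕜 := ℂ)))

theorem mNorm_ne_top (hΦ : IsSNFunction Φ) (A : Matrix ι ι ℂ) : mNorm Φ A ≠ ∞ := by
  refine (idealNorm_lt_top_of_rank_le hΦ (N := Fintype.card ι) ?_).ne
  refine (LinearMap.rank_le_domain _).trans ?_
  rw [← Module.finrank_eq_rank, finrank_euclideanSpace]

/-- A principal submatrix is the compression by a coordinate isometry. For bijections this makes the
norm independent of the labelling of the index set. -/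
theorem mNorm_submatrix_le (hΦ : IsSNFunction Φ) (A : Matrix ι ι ℂ) {g : κ → ι}
    (hg : Function.Injective g) : mNorm Φ (A.submatrix g g) ≤ mNorm Φ A := by
  have ho : Orthonormal ℂ fun k => (EuclideanSpace.single (g k) 1 : EuclideanSpace ℂ ι) :=
    (EuclideanSpace.orthonormal_single (𝕜 := ℂ) (ι := ι)).comp g hg
  have h := adjoint_synth_comp_comp_synth
    (fun k => (EuclideanSpace.single (g k) 1 : EuclideanSpace ℂ ι))
    (fun k => (EuclideanSpace.single (g k) 1 : EuclideanSpace ℂ ι))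
    (Matrix.toEuclideanCLM (n := ι) (𝕜 := ℂ) A)
  have h2 : A.submatrix g g = Matrix.of fun i j => inner ℂ
      (EuclideanSpace.single (g i) 1 : EuclideanSpace ℂ ι)
      (Matrix.toEuclideanCLM (n := ι) (𝕜 := ℂ) A (EuclideanSpace.single (g j) 1)) := by
    ext i j
    rw [Matrix.of_apply, EuclideanSpace.inner_single_left, toEuclideanCLM_single]
    simp
  rw [mNorm, h2, ← h]
  refine idealNorm_comp_le_of_norm_le_one hΦ _ ?_ (norm_synth_le_one ho)
  rw [LinearIsometryEquiv.norm_map]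
  exact norm_synth_le_one ho

theorem mNorm_submatrix_equiv (hΦ : IsSNFunction Φ) (A : Matrix ι ι ℂ) (e : κ ≃ ι) :
    mNorm Φ (A.submatrix e e) = mNorm Φ A := by
  refine le_antisymm (mNorm_submatrix_le hΦ A e.injective) ?_
  simpa using mNorm_submatrix_le hΦ (A.submatrix e e) e.symm.injective

/-- Padding by zeros is conjugation `C A C*` with a coordinate isometry `C`. -/
theorem mNorm_extend_le (hΦ : IsSNFunction Φ) (A : Matrix κ κ ℂ) {g : κ → ι}
    (hg : Function.Injective g) (B : Matrix ι ι ℂ) (hB : B.submatrix g g = A)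
    (hB1 : ∀ i j, i ∉ Set.range g → B i j = 0) (hB2 : ∀ i j, j ∉ Set.range g → B i j = 0) :
    mNorm Φ B ≤ mNorm Φ A := by
  have ho : Orthonormal ℂ fun k => (EuclideanSpace.single (g k) 1 : EuclideanSpace ℂ ι) :=
    (EuclideanSpace.orthonormal_single (𝕜 := ℂ) (ι := ι)).comp g hg
  set C := synth fun k => (EuclideanSpace.single (g k) 1 : EuclideanSpace ℂ ι) with hC
  have h : Matrix.toEuclideanCLM (n := ι) (𝕜 := ℂ) B =
      C ∘L Matrix.toEuclideanCLM (n := κ) (𝕜 := ℂ) A ∘L adjoint C := by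
    rw [← toEuclideanCLM_inner (C ∘L Matrix.toEuclideanCLM (n := κ) (𝕜 := ℂ) A ∘L adjoint C)]
    congr 1
    ext i j
    rw [Matrix.of_apply, comp_apply, comp_apply, hC, synth_apply]
    simp only [WithLp.ofLp_sum, WithLp.ofLp_smul, Finset.sum_apply, Pi.smul_apply, smul_eq_mul,
      PiLp.single_apply, Matrix.ofLp_toEuclideanCLM, Matrix.mulVec, dotProduct]
    have hv : ∀ k, (adjoint (synth fun k => (EuclideanSpace.single (g k) 1 : EuclideanSpace ℂ ι))
        (EuclideanSpace.single j 1)) k = if g k = j then 1 else 0 := by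
      intro k
      rw [adjoint_synth_apply, EuclideanSpace.inner_single_left, PiLp.single_apply]
      simp
    simp only [hv]
    by_cases hi : i ∈ Set.range g
    · obtain ⟨k, rfl⟩ := hi
      by_cases hj : j ∈ Set.range g
      · obtain ⟨l, rfl⟩ := hj
        simp [hg.eq_iff, ← hB]
      · rw [hB2 _ _ hj, eq_comm]
        refine Finset.sum_eq_zero fun p _ => mul_eq_zero_of_left
          (Finset.sum_eq_zero fun q _ => ?_) _
        rw [if_neg fun h => hj ⟨q, h⟩, mul_zero]
    · rw [hB1 _ _ hi, eq_comm]
      refine Finset.sum_eq_zero fun p _ => ?_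
      rw [if_neg fun h => hi ⟨p, h.symm⟩, mul_zero]
  rw [mNorm, h]
  refine idealNorm_comp_le_of_norm_le_one hΦ _ (norm_synth_le_one ho) ?_
  rw [LinearIsometryEquiv.norm_map]
  exact norm_synth_le_one ho

theorem ofReal_norm_apply_le_mNorm (hΦ : IsSNFunction Φ) (A : Matrix ι ι ℂ) (i j : ι) :
    ENNReal.ofReal ‖A i j‖ ≤ mNorm Φ A := by
  refine le_trans (ENNReal.ofReal_le_ofReal ?_) (ofReal_norm_le_idealNorm hΦ _)
  rw [← toEuclideanCLM_single A i j]
  refine (PiLp.norm_apply_le _ i).trans ((le_opNorm _ _).trans_eq ?_)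
  simp

/-! ### Singular value decomposition -/

theorem norm_toEuclideanCLM_le_one {U : Matrix ι ι ℂ} (hU : star U * U = 1) :
    ‖Matrix.toEuclideanCLM (n := ι) (𝕜 := ℂ) U‖ ≤ 1 := by
  have h := CStarRing.norm_star_mul_self (x := Matrix.toEuclideanCLM (n := ι) (𝕜 := ℂ) U)
  rw [← map_star, ← map_mul, hU, map_one] at h
  have h3 : ‖(1 : EuclideanSpace ℂ ι →L[ℂ] EuclideanSpace ℂ ι)‖ ≤ 1 := norm_id_le
  nlinarith [norm_nonneg (Matrix.toEuclideanCLM (n := ι) (𝕜 := ℂ) U)]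

theorem sNumber_mul_mul_le {U V : Matrix ι ι ℂ} (hU : star U * U = 1) (hV : star V * V = 1)
    (D : Matrix ι ι ℂ) (k : ℕ) :
    sNumber (Matrix.toEuclideanCLM (n := ι) (𝕜 := ℂ) (U * D * V)) k ≤
      sNumber (Matrix.toEuclideanCLM (n := ι) (𝕜 := ℂ) D) k := by
  rw [map_mul, map_mul, mul_assoc]
  refine (sNumber_comp_le _ _ _ k).trans (mul_le_of_le_one_left (sNumber_nonneg _ k) ?_)
  exact mul_le_one₀ (norm_toEuclideanCLM_le_one hU) (norm_nonneg _) (norm_toEuclideanCLM_le_one hV)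

theorem sNumber_mul_mul {U V : Matrix ι ι ℂ} (hU : star U * U = 1) (hV : star V * V = 1)
    (D : Matrix ι ι ℂ) (k : ℕ) :
    sNumber (Matrix.toEuclideanCLM (n := ι) (𝕜 := ℂ) (U * D * V)) k =
      sNumber (Matrix.toEuclideanCLM (n := ι) (𝕜 := ℂ) D) k := by
  refine le_antisymm (sNumber_mul_mul_le hU hV D k) ?_
  have hU' : U * star U = 1 := mul_eq_one_comm.1 hU
  have hV' : V * star V = 1 := mul_eq_one_comm.1 hV
  have h := sNumber_mul_mul_le (U := star U) (V := star V) (by simpa using hU')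
    (by simpa using hV') (U * D * V) k
  have h2 : star U * (U * D * V) * star V = D := by
    calc star U * (U * D * V) * star V = (star U * U) * D * (V * star V) := by
          simp only [mul_assoc]
      _ = D := by rw [hU, hV', one_mul, mul_one]
  rwa [h2] at h

/-- The diagonal matrix with entries `s₀, …, s_{n-1}`. -/
abbrev diagMat (n : ℕ) (s : ℕ → ℝ) : Matrix (Fin n) (Fin n) ℂ :=
  Matrix.diagonal fun i => (s i : ℂ)

theorem diagMat_apply (n : ℕ) (s : ℕ → ℝ) (v : EuclideanSpace ℂ (Fin n)) (i : Fin n) :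
    Matrix.toEuclideanCLM (n := Fin n) (𝕜 := ℂ) (diagMat n s) v i = s i * v i := by
  rw [Matrix.ofLp_toEuclideanCLM, Matrix.mulVec_diagonal]

theorem sNumber_of_le {n : ℕ} (A : Matrix (Fin n) (Fin n) ℂ) {k : ℕ} (hk : n ≤ k) :
    sNumber (Matrix.toEuclideanCLM (n := Fin n) (𝕜 := ℂ) A) k = 0 := by
  refine sNumber_eq_zero_of_rank_le (N := n) ?_ hk
  refine (LinearMap.rank_le_domain _).trans ?_
  rw [← Module.finrank_eq_rank, finrank_euclideanSpace, Fintype.card_fin]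

/-- From above, a subspace of dimension `k + 1` contains a nonzero vector whose first `k`
coordinates vanish; from below, the first `k + 1` unit vectors span a suitable subspace. -/
theorem sNumber_diagMat {n : ℕ} {s : ℕ → ℝ} (hs : Antitone s) (h0 : ∀ i, 0 ≤ s i) {k : ℕ}
    (hk : k < n) : sNumber (Matrix.toEuclideanCLM (n := Fin n) (𝕜 := ℂ) (diagMat n s)) k = s k := by
  set D := Matrix.toEuclideanCLM (n := Fin n) (𝕜 := ℂ) (diagMat n s) with hD
  refine le_antisymm ?_ ?_
  · by_contra! hlt
    obtain ⟨r, h1, h2⟩ := exists_between hlt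
    obtain ⟨V, hV, hVD⟩ := exists_of_lt_sNumber ((h0 k).trans h1.le) h2
    have hVf : FiniteDimensional ℂ V := Module.finite_of_finrank_pos (by omega)
    let R : EuclideanSpace ℂ (Fin n) →ₗ[ℂ] (Fin k → ℂ) :=
      LinearMap.pi fun i => (EuclideanSpace.proj (Fin.castLE hk.le i) :
        EuclideanSpace ℂ (Fin n) →L[ℂ] ℂ).toLinearMap
    obtain ⟨v, hv, hv0⟩ := Submodule.exists_mem_ne_zero_of_ne_bot
      (LinearMap.ker_ne_bot_of_finrank_lt (f := R ∘ₗ V.subtype) (by simp [hV]))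
    have hz : ∀ i : Fin n, (i : ℕ) < k → (v : EuclideanSpace ℂ (Fin n)) i = 0 := by
      intro i hi
      have := congrFun (LinearMap.mem_ker.1 hv) ⟨i, hi⟩
      simpa [R] using this
    have hpos : 0 < ‖(v : EuclideanSpace ℂ (Fin n))‖ := norm_pos_iff.2 (by simpa using hv0)
    have hle : ‖D v‖ ≤ s k * ‖(v : EuclideanSpace ℂ (Fin n))‖ := by
      refine le_of_sq_le_sq ?_ (mul_nonneg (h0 k) hpos.le)
      rw [mul_pow, EuclideanSpace.norm_sq_eq, EuclideanSpace.norm_sq_eq, Finset.mul_sum]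
      refine Finset.sum_le_sum fun i _ => ?_
      rw [hD, diagMat_apply, norm_mul, mul_pow]
      by_cases hi : (i : ℕ) < k
      · simp [hz i hi]
      · refine mul_le_mul_of_nonneg_right ?_ (sq_nonneg _)
        rw [Complex.norm_real, Real.norm_of_nonneg (h0 i)]
        exact pow_le_pow_left₀ (h0 i) (hs (by omega)) 2
    have := (hVD v v.2).trans hle
    exact absurd (le_of_mul_le_mul_right this hpos) (not_le.2 h1)
  · let f : Fin (k + 1) → EuclideanSpace ℂ (Fin n) :=
      fun i => EuclideanSpace.single (Fin.castLE hk i) 1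
    have hf : Orthonormal ℂ f := (EuclideanSpace.orthonormal_single (𝕜 := ℂ) (ι := Fin n)).comp _
      (Fin.castLE_injective hk)
    refine le_sNumber (Submodule.span ℂ (Set.range f)) ?_ fun v hv => ?_
    · rw [finrank_span_eq_card hf.linearIndependent]
      simp
    · have hz : ∀ i : Fin n, k < (i : ℕ) → v i = 0 := by
        intro i hi
        have : Submodule.span ℂ (Set.range f) ≤
            LinearMap.ker (EuclideanSpace.proj i : EuclideanSpace ℂ (Fin n) →L[ℂ] ℂ).toLinearMap := by
          rw [Submodule.span_le]
          rintro _ ⟨j, rfl⟩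
          have : i ≠ Fin.castLE hk j := by
            intro h
            have := congrArg Fin.val h
            simp at this
            omega
          simp [f, this]
        simpa using this hv
      refine le_of_sq_le_sq ?_ (norm_nonneg _)
      rw [mul_pow, EuclideanSpace.norm_sq_eq, EuclideanSpace.norm_sq_eq, Finset.mul_sum]
      refine Finset.sum_le_sum fun i _ => ?_
      rw [hD, diagMat_apply, norm_mul, mul_pow]
      by_cases hi : k < (i : ℕ)
      · simp [hz i hi]
      · refine mul_le_mul_of_nonneg_right ?_ (sq_nonneg _)
        rw [Complex.norm_real, Real.norm_of_nonneg (h0 i)]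
        exact pow_le_pow_left₀ (h0 k) (hs (by omega)) 2

/-- The images under `T` of an orthonormal eigenbasis of `T* T` are orthogonal with norms `s i`.
Normalising the nonzero ones and completing them to an orthonormal basis yields the left singular
vectors. -/
theorem exists_svd {n : ℕ} (A : Matrix (Fin n) (Fin n) ℂ) :
    ∃ (U V : Matrix (Fin n) (Fin n) ℂ) (s : ℕ → ℝ), star U * U = 1 ∧ star V * V = 1 ∧
      Antitone s ∧ (∀ i, 0 ≤ s i) ∧ A = U * diagMat n s * V := by
  set X := Matrix.toEuclideanCLM (n := Fin n) (𝕜 := ℂ) A with hX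
  set T : EuclideanSpace ℂ (Fin n) →ₗ[ℂ] EuclideanSpace ℂ (Fin n) := X.toLinearMap with hT
  have hn : Module.finrank ℂ (EuclideanSpace ℂ (Fin n)) = n := by simp
  let v := T.isSymmetric_adjoint_comp_self.eigenvectorBasis hn
  let s : ℕ → ℝ := T.singularValues
  have hin : ∀ i j, inner ℂ (T (v i)) (T (v j)) = if i = j then ((s j : ℂ)) ^ 2 else 0 := by
    intro i j
    have h1 : (LinearMap.adjoint T ∘ₗ T) (v j) = ((s j : ℂ) ^ 2) • v j := by
      rw [T.isSymmetric_adjoint_comp_self.apply_eigenvectorBasis hn j,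
        ← T.sq_singularValues_fin hn]
      norm_cast
    rw [← LinearMap.adjoint_inner_right, ← LinearMap.comp_apply, h1, inner_smul_right,
      orthonormal_iff_ite.1 v.orthonormal]
    simp
  let S : Set (Fin n) := {i | s i ≠ 0}
  have hS : Orthonormal ℂ (S.domRestrict fun i => ((s i : ℂ)⁻¹) • T (v i)) := by
    rw [orthonormal_iff_ite]
    rintro ⟨i, hi⟩ ⟨j, hj⟩
    have hj' : (s j : ℂ) ≠ 0 := by exact_mod_cast hj
    simp only [Set.domRestrict_apply, inner_smul_left, inner_smul_right, hin, Subtype.mk.injEq]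
    split_ifs with h
    · subst h
      simp
      field_simp
    · simp
  obtain ⟨u, hu⟩ := hS.exists_orthonormalBasis_extension_of_card_eq (by simp)
  have hTv : ∀ i, T (v i) = (s i : ℂ) • u i := by
    intro i
    by_cases hi : s i = 0
    · have := hin i i
      rw [if_pos rfl, hi] at this
      simpa [hi] using this
    · rw [hu i hi, smul_smul, mul_inv_cancel₀ (by exact_mod_cast hi), one_smul]
  have hone : ∀ b : OrthonormalBasis (Fin n) ℂ (EuclideanSpace ℂ (Fin n)),
      adjoint (synth b) ∘L synth b = 1 := by
    intro b
    have := adjoint_synth_comp_comp_synth b b (ContinuousLinearMap.id ℂ _)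
    have h2 : (Matrix.of fun i j => inner ℂ (b i) ((ContinuousLinearMap.id ℂ _) (b j))) =
        (1 : Matrix (Fin n) (Fin n) ℂ) := by
      ext i j
      rw [Matrix.of_apply, ContinuousLinearMap.id_apply, orthonormal_iff_ite.1 b.orthonormal,
        Matrix.one_apply]
    rw [h2, map_one] at this
    exact this
  let c := Matrix.toEuclideanCLM (n := Fin n) (𝕜 := ℂ)
  have hmat : ∀ b : OrthonormalBasis (Fin n) ℂ (EuclideanSpace ℂ (Fin n)),
      star (c.symm (synth b)) * c.symm (synth b) = 1 := by
    intro b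
    apply EquivLike.injective c
    rw [map_mul, map_star, c.apply_symm_apply, map_one]
    exact hone b
  refine ⟨c.symm (synth u), star (c.symm (synth v)), s, hmat u, ?_, T.singularValues_antitone,
    T.singularValues_nonneg, ?_⟩
  · rw [star_star]
    exact mul_eq_one_comm.1 (hmat v)
  · have h1 : A * c.symm (synth v) = c.symm (synth u) * diagMat n s := by
      apply EquivLike.injective c
      rw [map_mul, map_mul, c.apply_symm_apply, c.apply_symm_apply]
      ext w i
      have e1 : (c A * synth v) w = ∑ j, w j • (s j : ℂ) • u j := by
        have : (c A * synth v) w = X (synth v w) := rfl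
        rw [this, synth_apply, map_sum]
        refine Finset.sum_congr rfl fun j _ => ?_
        rw [map_smul]
        congr 1
        exact hTv j
      have e2 : (synth u * c (diagMat n s)) w = ∑ j, w j • (s j : ℂ) • u j := by
        have : (synth u * c (diagMat n s)) w = synth u (c (diagMat n s) w) := rfl
        rw [this, synth_apply]
        refine Finset.sum_congr rfl fun j _ => ?_
        rw [diagMat_apply, smul_smul, mul_comm]
      rw [e1, e2]
    rw [← h1, mul_assoc, mul_eq_one_comm.1 (hmat v), mul_one]

theorem mNorm_svd (hΦ : IsSNFunction Φ) {n : ℕ} {U V : Matrix (Fin n) (Fin n) ℂ} {s : ℕ → ℝ}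
    (hU : star U * U = 1) (hV : star V * V = 1) (hs : Antitone s) (h0 : ∀ i, 0 ≤ s i) :
    mNorm Φ (U * diagMat n s * V) = ENNReal.ofReal (Φ (trunc s n)) := by
  rw [mNorm, idealNorm_eq_of_sNumber_eq_zero hΦ fun k hk => sNumber_of_le _ hk]
  congr 2
  ext i
  simp only [trunc_apply]
  split_ifs with hi
  · rw [sNumber_mul_mul hU hV, sNumber_diagMat hs h0 hi]
  · rfl

/-- Transposing a singular value decomposition exchanges the unitary factors and keeps the diagonal.
-/
theorem sNumber_transpose_fin {n : ℕ} (A : Matrix (Fin n) (Fin n) ℂ) (k : ℕ) :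
    sNumber (Matrix.toEuclideanCLM (n := Fin n) (𝕜 := ℂ) A.transpose) k =
      sNumber (Matrix.toEuclideanCLM (n := Fin n) (𝕜 := ℂ) A) k := by
  obtain ⟨U, V, s, hU, hV, -, -, rfl⟩ := exists_svd A
  have ht : ∀ W : Matrix (Fin n) (Fin n) ℂ, star W * W = 1 →
      star W.transpose * W.transpose = 1 := by
    intro W hW
    have : star W.transpose = (star W).transpose := by
      ext i j; simp [Matrix.star_apply]
    rw [this, ← Matrix.transpose_mul, mul_eq_one_comm.1 hW, Matrix.transpose_one]
  rw [Matrix.transpose_mul, Matrix.transpose_mul, ← mul_assoc, Matrix.diagonal_transpose,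
    sNumber_mul_mul (ht V hV) (ht U hU), sNumber_mul_mul hU hV]

theorem mNorm_transpose (hΦ : IsSNFunction Φ) (A : Matrix ι ι ℂ) :
    mNorm Φ A.transpose = mNorm Φ A := by
  have hfin : ∀ {n : ℕ} (B : Matrix (Fin n) (Fin n) ℂ), mNorm Φ B.transpose = mNorm Φ B := by
    intro n B
    have : sNumber (Matrix.toEuclideanCLM (n := Fin n) (𝕜 := ℂ) B.transpose) =
      sNumber (Matrix.toEuclideanCLM (n := Fin n) (𝕜 := ℂ) B) :=
      funext fun k => sNumber_transpose_fin B k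
    rw [mNorm, mNorm, idealNorm, idealNorm, this]
  have e := (Fintype.equivFin ι).symm
  rw [← mNorm_submatrix_equiv hΦ A e, ← mNorm_submatrix_equiv hΦ A.transpose e, ← hfin]
  rfl

theorem norm_toEuclideanCLM_transpose {n : ℕ} (A : Matrix (Fin n) (Fin n) ℂ) :
    ‖Matrix.toEuclideanCLM (n := Fin n) (𝕜 := ℂ) A.transpose‖ =
      ‖Matrix.toEuclideanCLM (n := Fin n) (𝕜 := ℂ) A‖ := by
  rw [← sNumber_zero_right, ← sNumber_zero_right, sNumber_transpose_fin]

end MatNorm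

end

section

/-! ### Trace duality -/

section TraceDuality

variable {Φ Ψ : (ℕ →₀ ℝ) → ℝ} {n : ℕ}

theorem sum_norm_sq_col {W : Matrix (Fin n) (Fin n) ℂ} (hW : star W * W = 1) (j : Fin n) :
    ∑ i, ‖W i j‖ ^ 2 = 1 := by
  have h := congrFun (congrFun hW j) j
  rw [Matrix.mul_apply, Matrix.one_apply_eq] at h
  have h2 : ∀ i, star W j i * W i j = ((‖W i j‖ ^ 2 : ℝ) : ℂ) := fun i => by
    rw [Matrix.star_apply, Complex.star_def, Complex.conj_mul']
    norm_cast
  simp only [h2] at h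
  exact_mod_cast h

theorem sum_norm_sq_row {W : Matrix (Fin n) (Fin n) ℂ} (hW : star W * W = 1) (i : Fin n) :
    ∑ j, ‖W i j‖ ^ 2 = 1 := by
  have h := sum_norm_sq_col (W := star W) (by rw [star_star]; exact mul_eq_one_comm.1 hW) i
  simpa [Matrix.star_apply] using h

/-- By Birkhoff's theorem `D` is a convex combination of permutation matrices, and for each of these
it is the rearrangement inequality. -/
theorem sum_mul_mem_doublyStochastic_le {s t : Fin n → ℝ} (hs : Antitone s) (ht : Antitone t)
    {D : Matrix (Fin n) (Fin n) ℝ} (hD : D ∈ doublyStochastic ℝ (Fin n)) :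
    ∑ i, ∑ j, s i * t j * D i j ≤ ∑ i, s i * t i := by
  obtain ⟨w, hw0, hw1, rfl⟩ := exists_eq_sum_perm_of_mem_doublyStochastic hD
  have h1 : ∑ i, ∑ j, s i * t j * (∑ σ, w σ • σ.permMatrix ℝ : Matrix (Fin n) (Fin n) ℝ) i j =
      ∑ σ : Equiv.Perm (Fin n), w σ * ∑ i, s i * t (σ i) := by
    simp only [Matrix.sum_apply, Matrix.smul_apply, smul_eq_mul, Finset.mul_sum]
    simp_rw [Finset.sum_comm (s := (Finset.univ : Finset (Fin n)))
      (t := (Finset.univ : Finset (Equiv.Perm (Fin n))))]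
    refine Finset.sum_congr rfl fun σ _ => Finset.sum_congr rfl fun i _ => ?_
    rw [Finset.sum_eq_single (σ i)]
    · simp [Equiv.Perm.permMatrix, PEquiv.toMatrix_apply]
      ring
    · intro j _ hj
      simp [Equiv.Perm.permMatrix, PEquiv.toMatrix_apply, Ne.symm hj]
    · simp
  rw [h1]
  calc ∑ σ : Equiv.Perm (Fin n), w σ * ∑ i, s i * t (σ i)
      ≤ ∑ σ : Equiv.Perm (Fin n), w σ * ∑ i, s i * t i :=
        Finset.sum_le_sum fun σ _ => mul_le_mul_of_nonneg_left
          (hs.monovary ht).sum_mul_comp_perm_le_sum_mul (hw0 σ)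
    _ = _ := by rw [← Finset.sum_mul, hw1, one_mul]

/-- Von Neumann's trace inequality. The trace is `∑ s i * P i j * t j * Q j i` with `P`, `Q`
unitary, and `|P i j * Q j i|` is at most the mean of the squared moduli, which form a doubly
stochastic matrix. -/
theorem norm_trace_svd_le {U V U' V' : Matrix (Fin n) (Fin n) ℂ} {s t : ℕ → ℝ}
    (hU : star U * U = 1) (hV : star V * V = 1) (hU' : star U' * U' = 1) (hV' : star V' * V' = 1)
    (hs : Antitone s) (hs0 : ∀ i, 0 ≤ s i) (ht : Antitone t) (ht0 : ∀ i, 0 ≤ t i) :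
    ‖((U * diagMat n s * V) * (U' * diagMat n t * V')).trace‖ ≤
      ∑ i : Fin n, s i * t i := by
  set P := V * U' with hP
  set Q := V' * U with hQ
  have hPu : star P * P = 1 := by
    rw [hP, star_mul, mul_assoc, ← mul_assoc (star V), hV, one_mul, hU']
  have hQu : star Q * Q = 1 := by
    rw [hQ, star_mul, mul_assoc, ← mul_assoc (star V'), hV', one_mul, hU]
  have h1 : ((U * diagMat n s * V) * (U' * diagMat n t * V')).trace =
      ∑ i : Fin n, ∑ j : Fin n, (s i : ℂ) * P i j * ((t j : ℂ) * Q j i) := by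
    have : (U * diagMat n s * V) * (U' * diagMat n t * V') =
        U * (diagMat n s * P * (diagMat n t * V')) := by
      simp only [hP, mul_assoc]
    rw [this, Matrix.trace_mul_comm]
    have : diagMat n s * P * (diagMat n t * V') * U = (diagMat n s * P) * (diagMat n t * Q) := by
      simp only [hQ, mul_assoc]
    rw [this, Matrix.trace]
    refine Finset.sum_congr rfl fun i _ => ?_
    rw [Matrix.diag_apply, Matrix.mul_apply]
    refine Finset.sum_congr rfl fun j _ => ?_
    rw [Matrix.diagonal_mul, Matrix.diagonal_mul]
  let D : Matrix (Fin n) (Fin n) ℝ := Matrix.of fun i j => (‖P i j‖ ^ 2 + ‖Q j i‖ ^ 2) / 2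
  have hD : D ∈ doublyStochastic ℝ (Fin n) := by
    rw [mem_doublyStochastic_iff_sum]
    refine ⟨fun i j => by simp only [D, Matrix.of_apply]; positivity, fun i => ?_, fun j => ?_⟩
    · simp only [D, Matrix.of_apply]
      rw [← Finset.sum_div, Finset.sum_add_distrib, sum_norm_sq_row hPu, sum_norm_sq_col hQu]
      norm_num
    · simp only [D, Matrix.of_apply]
      rw [← Finset.sum_div, Finset.sum_add_distrib, sum_norm_sq_col hPu, sum_norm_sq_row hQu]
      norm_num
  rw [h1]
  refine le_trans ?_ (sum_mul_mem_doublyStochastic_le (s := fun i : Fin n => s i)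
    (t := fun i : Fin n => t i) (fun i j h => hs h) (fun i j h => ht h) hD)
  refine norm_sum_le_of_le _ fun i _ => norm_sum_le_of_le _ fun j _ => ?_
  rw [norm_mul, norm_mul, norm_mul, Complex.norm_real, Complex.norm_real,
    Real.norm_of_nonneg (hs0 i), Real.norm_of_nonneg (ht0 j)]
  have h2 : ‖P i j‖ * ‖Q j i‖ ≤ D i j := by
    simp only [D, Matrix.of_apply]
    nlinarith [sq_nonneg (‖P i j‖ - ‖Q j i‖)]
  calc s i * ‖P i j‖ * (t j * ‖Q j i‖) = s i * t j * (‖P i j‖ * ‖Q j i‖) := by ring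
    _ ≤ _ := mul_le_mul_of_nonneg_left h2 (mul_nonneg (hs0 i) (ht0 j))

theorem sum_fin_le_adjointFn_mul (hΦ : IsSNFunction Φ) {s t : ℕ → ℝ} :
    ∑ i : Fin n, s i * t i ≤ adjointFn Φ (trunc s n) * Φ (trunc t n) := by
  refine le_trans ?_ (sum_abs_mul_abs_le hΦ (trunc s n) (trunc t n) n)
  rw [Finset.sum_range]
  refine Finset.sum_le_sum fun i _ => ?_
  rw [trunc_apply, trunc_apply, if_pos i.2, if_pos i.2, ← abs_mul]
  exact le_abs_self _

/-- Hölder's inequality for the trace. -/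
theorem ofReal_norm_trace_mul_le (hΦ : IsSNFunction Φ) (z w : Matrix (Fin n) (Fin n) ℂ) :
    ENNReal.ofReal ‖(z * w).trace‖ ≤ mNorm (adjointFn Φ) z * mNorm Φ w := by
  obtain ⟨U, V, s, hU, hV, hs, hs0, rfl⟩ := exists_svd z
  obtain ⟨U', V', t, hU', hV', ht, ht0, rfl⟩ := exists_svd w
  rw [mNorm_svd (isSNFunction_adjointFn hΦ) hU hV hs hs0, mNorm_svd hΦ hU' hV' ht ht0,
    ← ENNReal.ofReal_mul (adjointFn_nonneg hΦ _)]
  exact ENNReal.ofReal_le_ofReal ((norm_trace_svd_le hU hV hU' hV' hs hs0 ht ht0).trans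
    (sum_fin_le_adjointFn_mul hΦ))

/-- The converse of Hölder's inequality. For `w = U diag(s) V`, the test matrices `V* diag(ξ) U*`
turn the trace into the pairing of `ξ` with the singular values, which are already in decreasing
order. -/
theorem mNorm_adjointFn_le (hΦ : IsSNFunction Φ) (w : Matrix (Fin n) (Fin n) ℂ) {c : ℝ≥0∞}
    (h : ∀ y : Matrix (Fin n) (Fin n) ℂ, ENNReal.ofReal ‖(y * w).trace‖ ≤ c * mNorm Φ y) :
    mNorm (adjointFn Φ) w ≤ c := by
  obtain ⟨U, V, s, hU, hV, hs, hs0, rfl⟩ := exists_svd w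
  rw [mNorm_svd (isSNFunction_adjointFn hΦ) hU hV hs hs0]
  induction c with
  | top => exact le_top
  | coe c =>
  rw [ENNReal.ofReal_le_iff_le_toReal ENNReal.coe_ne_top, ENNReal.coe_toReal]
  have hdecr : ∀ i, decrRearr (trunc s n) i = trunc s n i := by
    intro i
    have hnn : ∀ j, 0 ≤ trunc s n j := fun j => by
      rw [trunc_apply]; split_ifs; exacts [hs0 j, le_rfl]
    rw [decrRearr_eq (trunc s n) (σ := 1), Equiv.Perm.one_apply, abs_of_nonneg (hnn i)]
    intro i j hij
    simp only [Equiv.Perm.one_apply, abs_of_nonneg (hnn _)]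
    simp only [trunc_apply]
    split_ifs
    · exact hs hij
    · omega
    · exact hs0 i
    · exact le_rfl
  refine Real.sSup_le ?_ c.2
  rintro r ⟨ξ, hξ, hξ0, hξa, rfl⟩
  rw [div_le_iff₀ (hΦ.pos hξ)]
  have hU' : U * star U = 1 := mul_eq_one_comm.1 hU
  have hV' : V * star V = 1 := mul_eq_one_comm.1 hV
  have h1 := h (star V * diagMat n ξ * star U)
  rw [mNorm_svd hΦ (by simpa using hV') (by simpa using hU') hξa hξ0, ← ENNReal.ofReal_coe_nnreal,
    ← ENNReal.ofReal_mul (NNReal.coe_nonneg c)] at h1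
  have h2 : (star V * diagMat n ξ * star U) * (U * diagMat n s * V) =
      star V * (diagMat n ξ * diagMat n s * V) := by
    calc _ = star V * diagMat n ξ * (star U * U) * (diagMat n s * V) := by simp only [mul_assoc]
      _ = _ := by rw [hU, mul_one]; simp only [mul_assoc]
  have h3 : ((star V * diagMat n ξ * star U) * (U * diagMat n s * V)).trace =
      ((∑ i : Fin n, ξ i * s i : ℝ) : ℂ) := by
    rw [h2, Matrix.trace_mul_comm, mul_assoc, hV', mul_one, Matrix.diagonal_mul_diagonal,
      Matrix.trace_diagonal]
    push_cast
    rfl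
  rw [h3, Complex.norm_real, ENNReal.ofReal_le_ofReal_iff
    (mul_nonneg (NNReal.coe_nonneg c) (hΦ.nonneg _))] at h1
  have h4 : (ξ.sum fun i c => decrRearr (trunc s n) i * c) ≤ ∑ i : Fin n, ξ i * s i := by
    rw [← Finset.sum_range fun i => ξ i * s i, Finsupp.sum]
    refine (Finset.sum_le_sum_of_subset_of_nonneg (t := ξ.support ∪ Finset.range n)
      Finset.subset_union_left fun i _ _ => ?_).trans (le_of_eq ?_)
    · rw [hdecr, trunc_apply]
      split_ifs
      · exact mul_nonneg (hs0 i) (hξ0 i)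
      · simp
    · rw [← Finset.sum_subset (s₁ := Finset.range n) Finset.subset_union_right]
      · refine Finset.sum_congr rfl fun i hi => ?_
        rw [hdecr, trunc_apply, if_pos (Finset.mem_range.1 hi), mul_comm]
      · intro i _ hi
        rw [hdecr, trunc_apply, if_neg (by simpa using hi), zero_mul]
  refine h4.trans ((Real.le_norm_self _).trans (h1.trans ?_))
  refine mul_le_mul_of_nonneg_left (hΦ.mono fun i => ?_) c.2
  rw [trunc_apply]
  split_ifs <;> simp

end TraceDuality

/-! ### The squared norm of `H(Φ, Ψ)` over a finite index set -/

section HSq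

variable {H : Type*} [NormedAddCommGroup H] [InnerProductSpace ℂ H]
  {ι κ : Type*} [Fintype ι] [DecidableEq ι] [Fintype κ] [DecidableEq κ]
  {Φ Ψ : (ℕ →₀ ℝ) → ℝ}

/-- The map `ρ_T` for matrices over a finite index set. -/
def gRho (T : Matrix ι ι H) (x : Matrix ι ι ℂ) : Matrix ι ι ℂ :=
  Matrix.of fun i l => ∑ j, ∑ k, inner ℂ (T l k) (T i j) * x j k

/-- The norm of `ρ_T : 𝔖_Φ → 𝔖_Ψ` on matrices over a finite index set. -/
def hSq (Φ Ψ : (ℕ →₀ ℝ) → ℝ) (T : Matrix ι ι H) : ℝ≥0∞ :=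
  ⨆ y, mNorm Ψ (gRho T y) / mNorm Φ y

theorem hSpace_eq {n : ℕ} (T : Matrix (Fin n) (Fin n) H) :
    hSpace H Φ Ψ n T = hSq Φ Ψ T ^ (1 / 2 : ℝ) := rfl

omit [DecidableEq ι] in
theorem gRho_zero (T : Matrix ι ι H) : gRho T 0 = 0 := by
  ext i l
  simp [gRho]

theorem mNorm_gRho_le (hΦ : IsSNFunction Φ) (hΨ : IsSNFunction Ψ) (T : Matrix ι ι H)
    (y : Matrix ι ι ℂ) : mNorm Ψ (gRho T y) ≤ hSq Φ Ψ T * mNorm Φ y := by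
  by_cases hy : y = 0
  · rw [hy, gRho_zero, mNorm_zero hΨ]
    simp
  · rw [← ENNReal.div_le_iff (mt (mNorm_eq_zero hΦ).1 hy) (mNorm_ne_top hΦ y)]
    exact le_iSup (fun y => mNorm Ψ (gRho T y) / mNorm Φ y) y

theorem hSq_le {T : Matrix ι ι H} {c : ℝ≥0∞}
    (h : ∀ y, mNorm Ψ (gRho T y) ≤ c * mNorm Φ y) : hSq Φ Ψ T ≤ c :=
  iSup_le fun y => ENNReal.div_le_of_le_mul (h y)

omit [DecidableEq ι] [DecidableEq κ] in
theorem gRho_submatrix (T : Matrix ι ι H) (y : Matrix ι ι ℂ) (e : κ ≃ ι) :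
    gRho (T.submatrix e e) (y.submatrix e e) = (gRho T y).submatrix e e := by
  ext i l
  simp only [gRho, Matrix.of_apply, Matrix.submatrix_apply]
  rw [← Equiv.sum_comp e]
  refine Finset.sum_congr rfl fun j _ => ?_
  rw [← Equiv.sum_comp e]

theorem hSq_le_submatrix_equiv (hΦ : IsSNFunction Φ) (hΨ : IsSNFunction Ψ) (T : Matrix ι ι H)
    (e : κ ≃ ι) : hSq Φ Ψ T ≤ hSq Φ Ψ (T.submatrix e e) := by
  refine hSq_le fun y => ?_
  rw [← mNorm_submatrix_equiv hΨ _ e, ← gRho_submatrix, ← mNorm_submatrix_equiv hΦ _ e]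
  exact mNorm_gRho_le hΦ hΨ _ _

theorem hSq_submatrix_equiv (hΦ : IsSNFunction Φ) (hΨ : IsSNFunction Ψ) (T : Matrix ι ι H)
    (e : κ ≃ ι) : hSq Φ Ψ (T.submatrix e e) = hSq Φ Ψ T := by
  refine le_antisymm ?_ (hSq_le_submatrix_equiv hΦ hΨ T e)
  simpa using hSq_le_submatrix_equiv hΦ hΨ (T.submatrix e e) e.symm

/-! ### Transposition and the adjoint pair `(Ψ*, Φ*)` -/

omit [DecidableEq ι] in
theorem sum_comm_four (f : ι → ι → ι → ι → ℂ) :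
    ∑ i, ∑ l, ∑ j, ∑ k, f i l j k = ∑ k, ∑ j, ∑ l, ∑ i, f i l j k := by
  refine (Finset.sum_comm.trans (Finset.sum_congr rfl fun l _ =>
    Finset.sum_comm.trans (Finset.sum_congr rfl fun j _ => Finset.sum_comm))).trans ?_
  exact (Finset.sum_comm.trans (Finset.sum_congr rfl fun j _ => Finset.sum_comm)).trans
    Finset.sum_comm

-- For `T = ∑ ξ_m ⊗ T_m` the trace adjoint of `y ↦ ∑ T_m y T_m*` is `z ↦ ∑ T_m* z T_m`. Conjugated
-- by transposition, this is `ρ` of the transpose of `T`.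
omit [DecidableEq ι] in
theorem trace_mul_gRho_transpose (T : Matrix ι ι H) (y z : Matrix ι ι ℂ) :
    (y * gRho T.transpose z).trace = (z.transpose * gRho T y.transpose).trace := by
  simp only [Matrix.trace, Matrix.diag_apply, Matrix.mul_apply, gRho, Matrix.of_apply,
    Matrix.transpose_apply, Finset.mul_sum]
  rw [sum_comm_four]
  refine Finset.sum_congr rfl fun k _ => Finset.sum_congr rfl fun j _ =>
    Finset.sum_congr rfl fun l _ => Finset.sum_congr rfl fun i _ => by ring

/-- An operator and its adjoint have the same norm; transposes of scalar matrices do not change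
`‖·‖_Φ`. The reverse inequality comes from applying this to the adjoint pair and using `Φ** = Φ`. -/
theorem hSq_transpose_le {n : ℕ} (hΦ : IsSNFunction Φ) (hΨ : IsSNFunction Ψ)
    (T : Matrix (Fin n) (Fin n) H) :
    hSq (adjointFn Ψ) (adjointFn Φ) T.transpose ≤ hSq Φ Ψ T := by
  refine hSq_le fun z => mNorm_adjointFn_le hΦ _ fun y => ?_
  rw [trace_mul_gRho_transpose]
  calc _ ≤ mNorm (adjointFn Ψ) z.transpose * mNorm Ψ (gRho T y.transpose) :=
        ofReal_norm_trace_mul_le hΨ _ _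
    _ ≤ mNorm (adjointFn Ψ) z.transpose * (hSq Φ Ψ T * mNorm Φ y.transpose) := by
        gcongr
        exact mNorm_gRho_le hΦ hΨ _ _
    _ = _ := by
        rw [mNorm_transpose (isSNFunction_adjointFn hΨ), mNorm_transpose hΦ]
        ring

theorem hSq_transpose {n : ℕ} (hΦ : IsSNFunction Φ) (hΨ : IsSNFunction Ψ)
    (T : Matrix (Fin n) (Fin n) H) :
    hSq (adjointFn Ψ) (adjointFn Φ) T.transpose = hSq Φ Ψ T := by
  refine le_antisymm (hSq_transpose_le hΦ hΨ T) ?_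
  have h := hSq_transpose_le (isSNFunction_adjointFn hΨ) (isSNFunction_adjointFn hΦ) T.transpose
  rwa [funext (adjointFn_adjointFn hΦ), funext (adjointFn_adjointFn hΨ),
    Matrix.transpose_transpose] at h

/-! ### Direct sums and repeated diagonal blocks -/

variable (H) in
/-- The first axiom of Ruan, for the norm of `H(Φ, Ψ)`. -/
def BlockMax (Φ Ψ : (ℕ →₀ ℝ) → ℝ) : Prop :=
  ∀ m n (S : Matrix (Fin m) (Fin m) H) (T : Matrix (Fin n) (Fin n) H),
    hSq Φ Ψ (Matrix.reindex finSumFinEquiv finSumFinEquiv (Matrix.fromBlocks S 0 0 T)) ≤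
      max (hSq Φ Ψ S) (hSq Φ Ψ T)

theorem IsOperatorSpace.blockMax (h : IsOperatorSpace (hSpace H Φ Ψ)) : BlockMax H Φ Ψ := by
  intro m n S T
  have h1 := h.ruan_one m n S T
  rw [hSpace_eq, hSpace_eq, hSpace_eq,
    ← (ENNReal.monotone_rpow_of_nonneg (by norm_num : (0 : ℝ) ≤ 1 / 2)).map_max] at h1
  exact ((ENNReal.rpow_left_injective (by norm_num)) h1).le

theorem BlockMax.adjoint (hΦ : IsSNFunction Φ) (hΨ : IsSNFunction Ψ) (h : BlockMax H Φ Ψ) :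
    BlockMax H (adjointFn Ψ) (adjointFn Φ) := by
  intro m n S T
  have h1 := h m n S.transpose T.transpose
  rw [← hSq_transpose hΦ hΨ S.transpose, ← hSq_transpose hΦ hΨ T.transpose,
    ← hSq_transpose hΦ hΨ, Matrix.transpose_reindex, Matrix.fromBlocks_transpose,
    Matrix.transpose_transpose, Matrix.transpose_transpose, Matrix.transpose_zero,
    Matrix.transpose_zero] at h1
  exact h1

theorem BlockMax.fromBlocks_le (hΦ : IsSNFunction Φ) (hΨ : IsSNFunction Ψ) (h : BlockMax H Φ Ψ)
    (S : Matrix ι ι H) (T : Matrix κ κ H) :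
    hSq Φ Ψ (Matrix.fromBlocks S 0 0 T) ≤ max (hSq Φ Ψ S) (hSq Φ Ψ T) := by
  let e := (Fintype.equivFin ι).symm
  let f := (Fintype.equivFin κ).symm
  have h1 := h _ _ (S.submatrix e e) (T.submatrix f f)
  rw [hSq_submatrix_equiv hΦ hΨ, hSq_submatrix_equiv hΦ hΨ, Matrix.reindex_apply,
    hSq_submatrix_equiv hΦ hΨ] at h1
  rw [← hSq_submatrix_equiv hΦ hΨ _ (Equiv.sumCongr e f)]
  convert h1 using 2
  ext (i | i) (j | j) <;> rfl

/-- The block-diagonal matrix with `k` blocks equal to `S`. -/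
def ampl (S : Matrix ι ι H) (κ : Type*) [DecidableEq κ] : Matrix (ι × κ) (ι × κ) H :=
  Matrix.of fun p q => if p.2 = q.2 then S p.1 q.1 else 0

theorem BlockMax.ampl_le (hΦ : IsSNFunction Φ) (hΨ : IsSNFunction Ψ) (h : BlockMax H Φ Ψ)
    (S : Matrix ι ι H) (k : ℕ) : hSq Φ Ψ (ampl S (Fin k)) ≤ hSq Φ Ψ S := by
  induction k with
  | zero =>
    refine hSq_le fun y => ?_
    have : gRho (ampl S (Fin 0)) y = 0 := by ext i; exact i.2.elim0
    rw [this, mNorm_zero hΨ]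
    simp
  | succ k ih =>
    -- The relabelling that splits off the last of the `k + 1` diagonal blocks.
    let e : (ι × Fin k) ⊕ ι ≃ ι × Fin (k + 1) :=
      ((Equiv.sumCongr (Equiv.refl _) (Equiv.prodUnique ι (Fin 1)).symm).trans
        (Equiv.prodSumDistrib ι (Fin k) (Fin 1)).symm).trans
        (Equiv.prodCongr (Equiv.refl ι) finSumFinEquiv)
    have h1 : (ampl S (Fin (k + 1))).submatrix e e = Matrix.fromBlocks (ampl S (Fin k)) 0 0 S := by
      ext (i | i) (j | j)
      · simp [e, ampl]
      · have : (Fin.castAdd 1 i.2) ≠ Fin.natAdd k (0 : Fin 1) := by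
          intro h
          have := congrArg Fin.val h
          simp at this
          omega
        simp [e, ampl, this]
      · have : Fin.natAdd k (0 : Fin 1) ≠ (Fin.castAdd 1 j.2) := by
          intro h
          have := congrArg Fin.val h
          simp at this
          omega
        simp [e, ampl, this]
      · simp [e, ampl]
    rw [← hSq_submatrix_equiv hΦ hΨ _ e, h1]
    exact (h.fromBlocks_le hΦ hΨ _ _).trans (max_le ih le_rfl)

end HSq

end

section

/-! ### Tensor products of operators -/

open Filter Topology ContinuousLinearMap

section Tensor

variable {H : Type*} [NormedAddCommGroup H] [InnerProductSpace ℂ H]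

/-- Distinct vectors of an orthonormal set are at distance `√2`, so the balls of radius `1 / 2`
around them are disjoint, and separability makes a maximal such set countable. -/
theorem exists_orthonormal_seq [CompleteSpace H] [TopologicalSpace.SeparableSpace H]
    (hH : ¬ FiniteDimensional ℂ H) :
    ∃ b : ℕ → H, Orthonormal ℂ b ∧ (Submodule.span ℂ (Set.range b))ᗮ = ⊥ := by
  obtain ⟨w, -, hw, hmax⟩ := exists_maximal_orthonormal (orthonormal_empty ℂ H)
  have hbot := (maximal_orthonormal_iff_orthogonalComplement_eq_bot hw).1 hmax
  have hcount : Countable w := by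
    refine Pairwise.countable_of_isOpen_disjoint
      (s := fun i : w => Metric.ball (i : H) (1 / 2)) (fun i j hij => ?_)
      (fun _ => Metric.isOpen_ball) fun i => Metric.nonempty_ball.2 (by norm_num)
    refine Metric.ball_disjoint_ball ?_
    have h1 : ‖(i : H) - j‖ ^ 2 = 2 := by
      rw [@norm_sub_sq ℂ, hw.inner_eq_zero hij, hw.norm_eq_one, hw.norm_eq_one]
      norm_num
    rw [dist_eq_norm]
    nlinarith [norm_nonneg ((i : H) - j)]
  have hinf : Infinite w := by
    by_contra hfin
    rw [not_infinite_iff_finite] at hfin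
    apply hH
    have hf : FiniteDimensional ℂ (Submodule.span ℂ w) :=
      FiniteDimensional.span_of_finite ℂ (Set.toFinite w)
    have htop : Submodule.span ℂ w = ⊤ := (Submodule.orthogonal_eq_bot_iff).1 hbot
    rw [htop] at hf
    exact Module.Finite.equiv (Submodule.topEquiv (R := ℂ) (M := H))
  obtain ⟨e⟩ := nonempty_equiv_of_countable (α := ℕ) (β := w)
  refine ⟨fun n => (e n : H), hw.comp e e.injective, ?_⟩
  have : Set.range (fun n => (e n : H)) = w := by
    rw [show (fun n => (e n : H)) = Subtype.val ∘ e from rfl, e.surjective.range_comp,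
      Subtype.range_coe]
  rw [this]
  exact hbot

/-- Elementary tensors in the completed tensor product. -/
def tens (v w : H) : UniformSpace.Completion (H ⊗[ℂ] H) :=
  ((v ⊗ₜ[ℂ] w : H ⊗[ℂ] H) : UniformSpace.Completion (H ⊗[ℂ] H))

theorem inner_tens (v w v' w' : H) :
    inner ℂ (tens v w) (tens v' w') = inner ℂ v v' * inner ℂ w w' := by
  rw [tens, tens, UniformSpace.Completion.inner_coe, TensorProduct.inner_tmul]

/-- The map `w ↦ v ⊗ w`. -/
def tensLeft (v : H) : H →L[ℂ] UniformSpace.Completion (H ⊗[ℂ] H) :=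
  UniformSpace.Completion.toComplL (𝕜 := ℂ) (E := H ⊗[ℂ] H) ∘L TensorProduct.mkL ℂ H H v

/-- The map `v ↦ v ⊗ w`. -/
def tensRight (w : H) : H →L[ℂ] UniformSpace.Completion (H ⊗[ℂ] H) :=
  UniformSpace.Completion.toComplL (𝕜 := ℂ) (E := H ⊗[ℂ] H) ∘L (TensorProduct.mkL ℂ H H).flip w

theorem tensLeft_apply (v w : H) : tensLeft v w = tens v w := rfl

theorem tensRight_apply (v w : H) : tensRight w v = tens v w := rfl

theorem tensorOp_tens (x a : H →L[ℂ] H) (v w : H) :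
    tensorOp x a (tens v w) = tens (x v) (a w) := tensorOp_tmul x a v w

theorem norm_tens (v w : H) : ‖tens v w‖ = ‖v‖ * ‖w‖ := by
  rw [tens, UniformSpace.Completion.norm_coe, TensorProduct.norm_tmul]

theorem norm_tensLeft_le (v : H) : ‖tensLeft v‖ ≤ ‖v‖ :=
  opNorm_le_bound _ (norm_nonneg _) fun w => by rw [tensLeft_apply, norm_tens]

theorem norm_tensRight_le (w : H) : ‖tensRight w‖ ≤ ‖w‖ :=
  opNorm_le_bound _ (norm_nonneg _) fun v => by rw [tensRight_apply, norm_tens, mul_comm]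

theorem clm_ext_tens {F : Type*} [NormedAddCommGroup F] [NormedSpace ℂ F]
    {X Y : UniformSpace.Completion (H ⊗[ℂ] H) →L[ℂ] F}
    (h : ∀ v w, X (tens v w) = Y (tens v w)) : X = Y := by
  refine ContinuousLinearMap.ext fun z => ?_
  refine UniformSpace.Completion.induction_on z
    (isClosed_eq X.continuous Y.continuous) fun z => ?_
  induction z with
  | zero => rw [UniformSpace.Completion.coe_zero, map_zero, map_zero]
  | tmul v w => exact h v w
  | add z w hz hw => rw [UniformSpace.Completion.coe_add, map_add, map_add, hz, hw]

variable {b : ℕ → H}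

theorem orthonormal_tens {ι : Type*} {f : ι → H} (hf : Orthonormal ℂ f) :
    Orthonormal ℂ fun p : ι × ι => tens (f p.1) (f p.2) := by
  classical
  rw [orthonormal_iff_ite]
  intro p q
  rw [inner_tens, orthonormal_iff_ite.1 hf, orthonormal_iff_ite.1 hf]
  by_cases h1 : p.1 = q.1 <;> by_cases h2 : p.2 = q.2 <;> simp [h1, h2, Prod.ext_iff]

theorem orthonormal_fin (hb : Orthonormal ℂ b) (m : ℕ) :
    Orthonormal ℂ fun i : Fin m => b i := hb.comp _ Fin.val_injective

theorem synth_adjoint_synth {E : Type*} [NormedAddCommGroup E] [InnerProductSpace ℂ E]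
    [CompleteSpace E] {ι : Type*} [Fintype ι] {f : ι → E} (hf : Orthonormal ℂ f)
    [(Submodule.span ℂ (Set.range f)).HasOrthogonalProjection] (z : E) :
    (Submodule.span ℂ (Set.range f)).starProjection z = synth f (adjoint (synth f) z) := by
  classical
  refine Submodule.eq_starProjection_of_mem_of_inner_eq_zero ?_ fun w hw => ?_
  · rw [synth_apply]
    exact Submodule.sum_mem _ fun i _ =>
      Submodule.smul_mem _ _ (Submodule.subset_span (Set.mem_range_self i))
  · induction hw using Submodule.span_induction with
    | mem w hw =>
      obtain ⟨i, rfl⟩ := hw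
      rw [← inner_conj_symm, inner_sub_right, synth_apply, inner_sum]
      simp only [inner_smul_right, orthonormal_iff_ite.1 hf, adjoint_synth_apply]
      simp
    | zero => simp
    | add u v _ _ hu hv => rw [inner_add_right, hu, hv, add_zero]
    | smul c u _ hu => rw [inner_smul_right, hu, mul_zero]

theorem norm_adjoint_synth_le_one {E : Type*} [NormedAddCommGroup E] [InnerProductSpace ℂ E]
    [CompleteSpace E] {ι : Type*} [Fintype ι] {f : ι → E} (hf : Orthonormal ℂ f) :
    ‖adjoint (synth f)‖ ≤ 1 := by
  rw [LinearIsometryEquiv.norm_map]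
  exact norm_synth_le_one hf

theorem norm_synth_adjoint_synth_le {E : Type*} [NormedAddCommGroup E] [InnerProductSpace ℂ E]
    [CompleteSpace E] {ι : Type*} [Fintype ι] {f : ι → E} (hf : Orthonormal ℂ f) (u : E) :
    ‖synth f (adjoint (synth f) u)‖ ≤ ‖u‖ := by
  have h1 := le_of_opNorm_le _ (norm_synth_le_one hf) (adjoint (synth f) u)
  have h2 := le_of_opNorm_le _ (norm_adjoint_synth_le_one hf) u
  linarith

/-- If the projections `Q m` onto finite orthonormal families tend strongly to the identity, so do
`Q m B Q m` to `B`. By lower semicontinuity, bounds for the matrix compressions then bound `B`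
itself, even when `B` is not compact. -/
theorem idealNorm_le_of_tendsto_synth {E : Type*} [NormedAddCommGroup E] [InnerProductSpace ℂ E]
    [CompleteSpace E] {ι : ℕ → Type*} [∀ m, Fintype (ι m)] [∀ m, DecidableEq (ι m)]
    {Ψ : (ℕ →₀ ℝ) → ℝ} (hΨ : IsSNFunction Ψ) {f : ∀ m, ι m → E} (hf : ∀ m, Orthonormal ℂ (f m))
    (ht : ∀ z, Tendsto (fun m => synth (f m) (adjoint (synth (f m)) z)) atTop (𝓝 z))
    {B : E →L[ℂ] E} {c : ℝ≥0∞}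
    (h : ∀ m, mNorm Ψ (Matrix.of fun i j => inner ℂ (f m i) (B (f m j))) ≤ c) :
    idealNorm Ψ B ≤ c := by
  set Q : ℕ → E → E := fun m z => synth (f m) (adjoint (synth (f m)) z) with hQ
  refine idealNorm_le_of_tendsto hΨ (l := atTop) (y := fun m => synth (f m) ∘L
    (adjoint (synth (f m)) ∘L B ∘L synth (f m)) ∘L adjoint (synth (f m)))
    (fun z => ?_) fun m => ?_
  · have h1 : Tendsto (fun m => Q m z) atTop (𝓝 z) := ht z
    have h2 : Tendsto (fun m => Q m (B z)) atTop (𝓝 (B z)) := ht (B z)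
    have h3 : Tendsto (fun m => Q m (B (Q m z)) - Q m (B z)) atTop (𝓝 0) := by
      have h4 : Tendsto (fun m => ‖B (Q m z - z)‖) atTop (𝓝 0) := by
        have h5 := (B.continuous.tendsto 0).comp
          (show Tendsto (fun m => Q m z - z) atTop (𝓝 0) by simpa using h1.sub_const z)
        rw [map_zero] at h5
        simpa using h5.norm
      refine squeeze_zero_norm (fun m => ?_) h4
      have : Q m (B (Q m z)) - Q m (B z) = Q m (B (Q m z - z)) := by
        simp only [hQ, map_sub]
      rw [this]
      exact norm_synth_adjoint_synth_le (hf m) _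
    have h6 := h3.add h2
    rw [zero_add] at h6
    refine h6.congr fun m => ?_
    rw [sub_add_cancel]
    rfl
  · have h1 := idealNorm_comp_le_of_norm_le_one hΨ (C := synth (f m)) (D := adjoint (synth (f m)))
      (adjoint (synth (f m)) ∘L B ∘L synth (f m)) (norm_synth_le_one (hf m))
      (norm_adjoint_synth_le_one (hf m))
    refine h1.trans ?_
    rw [adjoint_synth_comp_comp_synth]
    exact h m

/-- The vectors `b i ⊗ b j` with `i, j ≤ m`. -/
def tensFam (b : ℕ → H) (m : ℕ) (p : Fin (m + 1) × Fin (m + 1)) :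
    UniformSpace.Completion (H ⊗[ℂ] H) := tens (b p.1) (b p.2)

theorem orthonormal_tensFam (hb : Orthonormal ℂ b) (m : ℕ) : Orthonormal ℂ (tensFam b m) :=
  orthonormal_tens (orthonormal_fin hb (m + 1))

/-- The spans increase, so only density of their union is at stake. A vector orthogonal to all `b i
⊗ b j` is orthogonal to every `v ⊗ w`, by extending one tensor factor at a time. -/
theorem tendsto_tensFam [CompleteSpace H] (hb : Orthonormal ℂ b)
    (hd : (Submodule.span ℂ (Set.range b))ᗮ = ⊥) (z : UniformSpace.Completion (H ⊗[ℂ] H)) :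
    Tendsto (fun m => synth (tensFam b m) (adjoint (synth (tensFam b m)) z)) atTop (𝓝 z) := by
  have hfin : ∀ m, FiniteDimensional ℂ (Submodule.span ℂ (Set.range (tensFam b m))) := fun m =>
    FiniteDimensional.span_of_finite ℂ (Set.finite_range _)
  simp_rw [← synth_adjoint_synth (orthonormal_tensFam hb _)]
  refine Submodule.starProjection_tendsto_self _ (fun m n hmn => ?_) z ?_
  · refine Submodule.span_mono ?_
    rintro _ ⟨p, rfl⟩
    exact ⟨(Fin.castLE (by omega) p.1, Fin.castLE (by omega) p.2), rfl⟩
  · rw [top_le_iff, Submodule.topologicalClosure_eq_top_iff, Submodule.eq_bot_iff]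
    intro z hz
    have h1 : ∀ i j, inner ℂ z (tens (b i) (b j)) = 0 := by
      intro i j
      refine Submodule.inner_left_of_mem_orthogonal ?_ hz
      refine Submodule.mem_iSup_of_mem (max i j) (Submodule.subset_span ?_)
      exact ⟨(⟨i, by omega⟩, ⟨j, by omega⟩), rfl⟩
    have hzero : ∀ f : H →L[ℂ] ℂ, (∀ i, f (b i) = 0) → f = 0 := by
      intro f hf
      ext v
      have hle : Submodule.span ℂ (Set.range b) ≤ LinearMap.ker f.toLinearMap := by
        rw [Submodule.span_le]
        rintro _ ⟨i, rfl⟩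
        exact hf i
      have h2 : v ∈ (Submodule.span ℂ (Set.range b)).topologicalClosure := by
        rw [Submodule.topologicalClosure_eq_top_iff.2 hd]
        trivial
      exact Submodule.topologicalClosure_minimal _ hle f.isClosed_ker h2
    have h2 : ∀ v j, inner ℂ z (tens v (b j)) = 0 := by
      intro v j
      exact congrArg (fun g => g v) (hzero (innerSL ℂ z ∘L tensRight (b j)) fun i => h1 i j)
    have h3 : ∀ v w, inner ℂ z (tens v w) = 0 := by
      intro v w
      exact congrArg (fun g => g w) (hzero (innerSL ℂ z ∘L tensLeft v) fun j => h2 v j)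
    have h4 : innerSL ℂ z = 0 := clm_ext_tens fun v w => h3 v w
    have h5 := congrArg (fun g => g z) h4
    exact inner_self_eq_zero.1 h5

/-! ### Finite compressions and finite rank operators -/

variable {Φ Ψ : (ℕ →₀ ℝ) → ℝ}

/-- The compression of `x ⊗ a` to the span of the vectors `b i ⊗ b j` with `i, j ≤ m`. -/
def tMat (b : ℕ → H) (m : ℕ) (x a : H →L[ℂ] H) :
    Matrix (Fin (m + 1) × Fin (m + 1)) (Fin (m + 1) × Fin (m + 1)) ℂ :=
  Matrix.of fun p q => inner ℂ (b p.1) (x (b q.1)) * inner ℂ (b p.2) (a (b q.2))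

/-- The compression of `a` to the span of the vectors `b i` with `i ≤ m`. -/
def cMat (b : ℕ → H) (m : ℕ) (a : H →L[ℂ] H) : Matrix (Fin (m + 1)) (Fin (m + 1)) ℂ :=
  Matrix.of fun i j => inner ℂ (b i) (a (b j))

theorem tMat_eq (m : ℕ) (x a : H →L[ℂ] H) : tMat b m x a =
    Matrix.of fun p q => inner ℂ (tensFam b m p) (tensorOp x a (tensFam b m q)) := by
  ext p q
  rw [Matrix.of_apply, tensFam, tensFam, tensorOp_tens, inner_tens]
  rfl

theorem mNorm_tMat_le (hΨ : IsSNFunction Ψ) (hb : Orthonormal ℂ b) (m : ℕ) (x a : H →L[ℂ] H) :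
    mNorm Ψ (tMat b m x a) ≤ idealNorm Ψ (tensorOp x a) := by
  rw [mNorm, tMat_eq, ← adjoint_synth_comp_comp_synth]
  exact idealNorm_comp_le_of_norm_le_one hΨ _ (norm_adjoint_synth_le_one (orthonormal_tensFam hb m))
    (norm_synth_le_one (orthonormal_tensFam hb m))

theorem idealNorm_tensorOp_le [CompleteSpace H] (hΨ : IsSNFunction Ψ) (hb : Orthonormal ℂ b)
    (hd : (Submodule.span ℂ (Set.range b))ᗮ = ⊥) {x a : H →L[ℂ] H} {c : ℝ≥0∞}
    (h : ∀ m, mNorm Ψ (tMat b m x a) ≤ c) : idealNorm Ψ (tensorOp x a) ≤ c := by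
  refine idealNorm_le_of_tendsto_synth hΨ (orthonormal_tensFam hb) (tendsto_tensFam hb hd)
    fun m => ?_
  rw [← tMat_eq]
  exact h m

variable [CompleteSpace H]

theorem mNorm_cMat_le (hΦ : IsSNFunction Φ) (hb : Orthonormal ℂ b) (m : ℕ) (a : H →L[ℂ] H) :
    mNorm Φ (cMat b m a) ≤ idealNorm Φ a := by
  rw [mNorm, cMat, ← adjoint_synth_comp_comp_synth (fun i : Fin (m + 1) => b i)]
  exact idealNorm_comp_le_of_norm_le_one hΦ _
    (norm_adjoint_synth_le_one (orthonormal_fin hb _)) (norm_synth_le_one (orthonormal_fin hb _))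

/-- The operator on `H` with matrix `y` with respect to the vectors `f i`. -/
def ofMat {ι : Type*} [Fintype ι] [DecidableEq ι] (f : ι → H) (y : Matrix ι ι ℂ) : H →L[ℂ] H :=
  synth f ∘L Matrix.toEuclideanCLM (n := ι) (𝕜 := ℂ) y ∘L adjoint (synth f)

section OfMat

variable {ι : Type*} [Fintype ι] [DecidableEq ι] {f : ι → H} (hf : Orthonormal ℂ f)
include hf

theorem idealNorm_ofMat_le (hΦ : IsSNFunction Φ) (y : Matrix ι ι ℂ) :
    idealNorm Φ (ofMat f y) ≤ mNorm Φ y :=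
  idealNorm_comp_le_of_norm_le_one hΦ _ (norm_synth_le_one hf) (norm_adjoint_synth_le_one hf)

theorem ofMat_mem_symmIdeal (hΦ : IsSNFunction Φ) (y : Matrix ι ι ℂ) :
    ofMat f y ∈ symmIdeal (E := H) Φ :=
  ⟨((isCompactOperator_of_finrank_range (F := Matrix.toEuclideanCLM (n := ι) (𝕜 := ℂ) y)).comp_clm
    (adjoint (synth f))).clm_comp (synth f),
    (idealNorm_ofMat_le hf hΦ y).trans_lt (mNorm_ne_top hΦ y).lt_top⟩

theorem inner_ofMat (y : Matrix ι ι ℂ) (i j : ι) : inner ℂ (f i) (ofMat f y (f j)) = y i j := by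
  have h1 : ∀ j, adjoint (synth f) (f j) = EuclideanSpace.single j 1 := by
    intro j
    ext i
    rw [adjoint_synth_apply, orthonormal_iff_ite.1 hf, PiLp.single_apply]
  rw [ofMat, comp_apply, comp_apply, ← adjoint_inner_left, h1, h1,
    EuclideanSpace.inner_single_left, toEuclideanCLM_single]
  simp

theorem ofMat_ne_zero {y : Matrix ι ι ℂ} (hy : y ≠ 0) : ofMat f y ≠ 0 := by
  intro h
  refine hy (Matrix.ext fun i j => ?_)
  rw [← inner_ofMat hf y, h]
  simp

end OfMat

omit [CompleteSpace H] in
theorem idealNorm_ne_zero (hΦ : IsSNFunction Φ) {a : H →L[ℂ] H} (h : a ≠ 0) :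
    idealNorm Φ a ≠ 0 := mt (idealNorm_eq_zero hΦ).1 h

/-- The supremum of `‖x ⊗ a‖_Ψ / ‖a‖_Φ` over the nonzero `a ∈ 𝔖_Φ`. -/
def tensSup (Φ Ψ : (ℕ →₀ ℝ) → ℝ) (x : H →L[ℂ] H) : ℝ≥0∞ :=
  ⨆ a ∈ {a ∈ symmIdeal (E := H) Φ | a ≠ 0}, idealNorm Ψ (tensorOp x a) / idealNorm Φ a

omit [CompleteSpace H] in
theorem idealNorm_tensorOp_le_tensSup (hΦ : IsSNFunction Φ) (x : H →L[ℂ] H) {a : H →L[ℂ] H}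
    (ha : a ∈ symmIdeal (E := H) Φ) (h0 : a ≠ 0) :
    idealNorm Ψ (tensorOp x a) ≤ tensSup Φ Ψ x * idealNorm Φ a := by
  rw [← ENNReal.div_le_iff (idealNorm_ne_zero hΦ h0) ha.2.ne]
  exact le_iSup₂ (f := fun a (_ : a ∈ {a ∈ symmIdeal (E := H) Φ | a ≠ 0}) =>
    idealNorm Ψ (tensorOp x a) / idealNorm Φ a) a ⟨ha, h0⟩

omit [CompleteSpace H] in
theorem tensSup_le {x : H →L[ℂ] H} {c : ℝ≥0∞} (h : ∀ a ∈ symmIdeal (E := H) Φ,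
    idealNorm Ψ (tensorOp x a) ≤ c * idealNorm Φ a) : tensSup Φ Ψ x ≤ c :=
  iSup₂_le fun a ha => ENNReal.div_le_of_le_mul (h a ha.1)

theorem inner_star_mul_self_apply (x : H →L[ℂ] H) (u v : H) :
    inner ℂ u ((star x * x) v) = inner ℂ (x u) (x v) := adjoint_inner_right x u (x v)

/-! ### The upper bound for the norm of `H(Φ, Ψ)` -/

theorem hSq_map_le (hΦ : IsSNFunction Φ) (hΨ : IsSNFunction Ψ) (hb : Orthonormal ℂ b)
    (x : H →L[ℂ] H) {n : ℕ} (T : Matrix (Fin n) (Fin n) H) :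
    hSq Φ Ψ (T.map x) ≤ tensSup Φ Ψ (star x * x) *
      ENNReal.ofReal ‖Matrix.toEuclideanCLM (n := Fin n) (𝕜 := ℂ) (gRho T 1)‖ := by
  refine hSq_le fun y => ?_
  by_cases hy : y = 0
  · rw [hy, gRho_zero, mNorm_zero hΨ]
    simp
  have hbn := orthonormal_fin hb n
  -- The transpose appears because the inner products in `ρ_T` carry the index `l` of the second
  -- factor in the conjugate-linear slot; it does not affect the norm.
  let a := ofMat (fun i : Fin n => b i) y.transpose
  have ha0 : a ≠ 0 := ofMat_ne_zero hbn (by simpa using hy)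
  -- The rows of `T`, read as vectors of `H ⊗ H`. The Gram matrix of these vectors is the transpose
  -- of `ρ_T(1)`, which gives the norm of `Z`.
  let Z := synth fun l : Fin n => ∑ k, tens (T l k) (b k)
  have h1 : adjoint Z ∘L tensorOp (star x * x) a ∘L Z =
      Matrix.toEuclideanCLM (n := Fin n) (𝕜 := ℂ) (gRho (T.map x) y).transpose := by
    rw [adjoint_synth_comp_comp_synth]
    congr 2
    ext l i
    simp only [Matrix.of_apply, gRho, map_sum, sum_inner, inner_sum,
      tensorOp_tens, inner_tens, inner_star_mul_self_apply, Matrix.map_apply]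
    refine Finset.sum_congr rfl fun j _ => Finset.sum_congr rfl fun k _ => ?_
    rw [inner_ofMat hbn, Matrix.transpose_apply]
  have h2 : ‖Z‖ * ‖Z‖ = ‖Matrix.toEuclideanCLM (n := Fin n) (𝕜 := ℂ) (gRho T 1)‖ := by
    rw [norm_synth_sq, ← norm_toEuclideanCLM_transpose]
    congr 2
    ext l i
    simp only [Matrix.of_apply, Matrix.transpose_apply, gRho, sum_inner, inner_sum, inner_tens,
      orthonormal_iff_ite.1 hbn, Matrix.one_apply]
    refine Finset.sum_congr rfl fun j _ => Finset.sum_congr rfl fun k _ => ?_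
    simp only [eq_comm]
  rw [← mNorm_transpose hΨ, mNorm, ← h1]
  refine (idealNorm_comp_le hΨ _ _ _).trans ?_
  rw [LinearIsometryEquiv.norm_map, h2]
  calc _ ≤ ENNReal.ofReal ‖Matrix.toEuclideanCLM (n := Fin n) (𝕜 := ℂ) (gRho T 1)‖ *
        (tensSup Φ Ψ (star x * x) * idealNorm Φ a) := by
        gcongr
        exact idealNorm_tensorOp_le_tensSup hΦ _ (ofMat_mem_symmIdeal hbn hΦ _) ha0
    _ ≤ ENNReal.ofReal ‖Matrix.toEuclideanCLM (n := Fin n) (𝕜 := ℂ) (gRho T 1)‖ *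
        (tensSup Φ Ψ (star x * x) * mNorm Φ y) := by
        gcongr
        exact (idealNorm_ofMat_le hbn hΦ _).trans_eq (mNorm_transpose hΦ y)
    _ = _ := by ring

/-! ### The lower bound for the norm of `H(Φ, Ψ)` -/

/-- The matrix with first column `v` and zeros elsewhere. -/
def colT {m : ℕ} (v : Fin (m + 1) → H) : Matrix (Fin (m + 1)) (Fin (m + 1)) H :=
  Matrix.of fun i j => if j = 0 then v i else 0

omit [CompleteSpace H] in
theorem gRho_colT {m : ℕ} (v : Fin (m + 1) → H) (y : Matrix (Fin (m + 1)) (Fin (m + 1)) ℂ)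
    (i l : Fin (m + 1)) : gRho (colT v) y i l = inner ℂ (v l) (v i) * y 0 0 := by
  simp only [gRho, colT, Matrix.of_apply]
  rw [Finset.sum_eq_single 0, Finset.sum_eq_single 0]
  · simp
  · intro k _ hk
    simp [hk]
  · simp
  · intro j _ hj
    simp [hj]
  · simp

omit [CompleteSpace H] in
theorem gRho_ampl_colT {m : ℕ} (v : Fin (m + 1) → H) {κ : Type*} [Fintype κ] [DecidableEq κ]
    (y : Matrix (Fin (m + 1) × κ) (Fin (m + 1) × κ) ℂ) (p q : Fin (m + 1) × κ) :
    gRho (ampl (colT v) κ) y p q = inner ℂ (v q.1) (v p.1) * y (0, p.2) (0, q.2) := by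
  simp only [gRho, ampl, colT, Matrix.of_apply]
  rw [Finset.sum_eq_single (0, p.2), Finset.sum_eq_single (0, q.2)]
  · simp
  · intro k _ hk
    have : ¬ (q.2 = k.2 ∧ k.1 = 0) := fun h => hk (Prod.ext h.2 h.1.symm)
    by_cases h1 : q.2 = k.2
    · have h2 : k.1 ≠ 0 := fun h => this ⟨h1, h⟩
      simp [h2]
    · simp [h1]
  · simp
  · intro j _ hj
    refine Finset.sum_eq_zero fun k _ => ?_
    have : ¬ (p.2 = j.2 ∧ j.1 = 0) := fun h => hj (Prod.ext h.2 h.1.symm)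
    by_cases h1 : p.2 = j.2
    · have h2 : j.1 ≠ 0 := fun h => this ⟨h1, h⟩
      simp [h2]
    · simp [h1]
  · simp

omit [CompleteSpace H] in
theorem ampl_colT_map {m : ℕ} (v : Fin (m + 1) → H) {κ : Type*} [DecidableEq κ]
    (x : H →ₗ[ℂ] H) : (ampl (colT v) κ).map x = ampl (colT fun i => x (v i)) κ := by
  ext p q
  simp only [ampl, colT, Matrix.map_apply, Matrix.of_apply, apply_ite x, map_zero]

/-- In each block only the first column is nonzero, so `ρ` sees `y` only through its entries with
both first indices `0`. Placing the transposed compression of `a` there and zeros elsewhere produces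
the compression of `|x|² ⊗ a`, up to a transpose. -/
theorem mNorm_tMat_le_hSq (hΦ : IsSNFunction Φ) (hΨ : IsSNFunction Ψ) (hb : Orthonormal ℂ b)
    (m : ℕ) (x a : H →L[ℂ] H) :
    mNorm Ψ (tMat b m (star x * x) a) ≤
      hSq Φ Ψ (ampl (colT fun i : Fin (m + 1) => x (b i)) (Fin (m + 1))) * idealNorm Φ a := by
  let y : Matrix (Fin (m + 1) × Fin (m + 1)) (Fin (m + 1) × Fin (m + 1)) ℂ :=
    Matrix.of fun p q => if p.1 = 0 ∧ q.1 = 0 then (cMat b m a).transpose p.2 q.2 else 0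
  have h1 : gRho (ampl (colT fun i : Fin (m + 1) => x (b i)) (Fin (m + 1))) y =
      (tMat b m (star x * x) a).transpose := by
    ext p q
    rw [gRho_ampl_colT, Matrix.transpose_apply]
    rw [tMat, Matrix.of_apply, inner_star_mul_self_apply]
    simp [y, cMat]
  have h2 : mNorm Φ y ≤ idealNorm Φ a := by
    refine le_trans ?_ (mNorm_cMat_le hΦ hb m a)
    rw [← mNorm_transpose hΦ (cMat b m a)]
    refine mNorm_extend_le hΦ _ (g := fun k => (0, k)) (Prod.mk_right_injective 0) y ?_ ?_ ?_
    · ext k l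
      simp [y]
    · intro p q hp
      have : p.1 ≠ 0 := fun h => hp ⟨p.2, Prod.ext h.symm rfl⟩
      simp [y, this]
    · intro p q hq
      have : q.1 ≠ 0 := fun h => hq ⟨q.2, Prod.ext h.symm rfl⟩
      simp [y, this]
  rw [← mNorm_transpose hΨ, ← h1]
  refine (mNorm_gRho_le hΦ hΨ _ y).trans ?_
  gcongr

/-- A single column sends `y` to `y 0 0` times a transposed compression of `|x|²`, and `|y 0 0| ≤
‖y‖_Φ`. -/
theorem hSq_colT_le (hΦ : IsSNFunction Φ) (hΨ : IsSNFunction Ψ) (hb : Orthonormal ℂ b) (m : ℕ)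
    (x : H →L[ℂ] H) : hSq Φ Ψ (colT fun i : Fin (m + 1) => x (b i)) ≤
      idealNorm Ψ (star x * x) := by
  refine hSq_le fun y => ?_
  have h1 : gRho (colT fun i : Fin (m + 1) => x (b i)) y =
      (y 0 0 • cMat b m (star x * x)).transpose := by
    ext i l
    rw [gRho_colT, Matrix.transpose_apply, Matrix.smul_apply, cMat, Matrix.of_apply,
      inner_star_mul_self_apply, smul_eq_mul, mul_comm]
  have h2 : Matrix.toEuclideanCLM (n := Fin (m + 1)) (𝕜 := ℂ) (y 0 0 • cMat b m (star x * x)) =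
      (y 0 0 • ContinuousLinearMap.id ℂ (EuclideanSpace ℂ (Fin (m + 1)))) ∘L
        Matrix.toEuclideanCLM (n := Fin (m + 1)) (𝕜 := ℂ) (cMat b m (star x * x)) ∘L
          ContinuousLinearMap.id ℂ _ := by
    rw [map_smul]
    ext
    simp
  rw [h1, mNorm_transpose hΨ, mNorm, h2]
  refine (idealNorm_comp_le hΨ _ _ _).trans ?_
  rw [mul_comm]
  refine mul_le_mul' (mNorm_cMat_le hΨ hb m _) ?_
  refine le_trans (ENNReal.ofReal_le_ofReal ?_) (ofReal_norm_apply_le_mNorm hΦ y 0 0)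
  calc _ ≤ (‖y 0 0‖ * 1) * 1 := by
        rw [norm_smul]
        gcongr <;> exact norm_id_le
    _ = _ := by ring

end Tensor

end

section

/-! ### Completely bounded norms -/

open Filter Topology ContinuousLinearMap

section Final

variable {H : Type*} [NormedAddCommGroup H] [InnerProductSpace ℂ H] {Φ Ψ : (ℕ →₀ ℝ) → ℝ}

theorem rowSpace_eq {n : ℕ} (T : Matrix (Fin n) (Fin n) H) : rowSpace H n T =
    ENNReal.ofReal ‖Matrix.toEuclideanCLM (n := Fin n) (𝕜 := ℂ) (gRho T 1)‖ ^ (1 / 2 : ℝ) := by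
  rw [ENNReal.ofReal_rpow_of_nonneg (norm_nonneg _) (by norm_num), ← Real.sqrt_eq_rpow]
  rfl

theorem mNorm_one_unique (hΦ : IsSNFunction Φ) :
    mNorm Φ (1 : Matrix (Fin 1) (Fin 1) ℂ) = 1 := by
  let s : ℕ → ℝ := fun i => if i = 0 then 1 else 0
  have hs : Antitone s := by
    intro i j hij
    simp only [s]
    split_ifs
    · exact le_rfl
    · omega
    · exact zero_le_one
    · exact le_rfl
  have h := mNorm_svd hΦ (n := 1) (U := 1) (V := 1) (s := s) (by simp) (by simp) hs
    (fun i => by simp only [s]; split_ifs <;> norm_num)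
  have h1 : (1 : Matrix (Fin 1) (Fin 1) ℂ) * diagMat 1 s * 1 = 1 := by
    rw [one_mul, mul_one]
    ext i j
    fin_cases i
    fin_cases j
    simp [s]
  have h2 : trunc s 1 = Finsupp.single 0 1 := by
    ext i
    rw [trunc_apply]
    by_cases hi : i = 0
    · subst hi; simp [s]
    · simp [s, hi]
  rwa [h1, h2, hΦ.normalized, ENNReal.ofReal_one] at h

theorem gRho_const (v : H) (i j : Fin 1) :
    gRho (Matrix.of fun _ _ : Fin 1 => v) 1 i j = ((‖v‖ ^ 2 : ℝ) : ℂ) := by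
  simp [gRho, inner_self_eq_norm_sq_to_K]

theorem rowSpace_const (v : H) : rowSpace H 1 (Matrix.of fun _ _ => v) = ENNReal.ofReal ‖v‖ := by
  have h : gRho (Matrix.of fun _ _ : Fin 1 => v) 1 =
      ((‖v‖ ^ 2 : ℝ) : ℂ) • (1 : Matrix (Fin 1) (Fin 1) ℂ) := by
    ext i j
    rw [gRho_const, Matrix.smul_apply, Subsingleton.elim i j, Matrix.one_apply_eq, smul_eq_mul,
      mul_one]
  have h1 : ‖(1 : EuclideanSpace ℂ (Fin 1) →L[ℂ] EuclideanSpace ℂ (Fin 1))‖ = 1 := norm_one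
  rw [rowSpace_eq, h, map_smul, map_one, norm_smul, h1, mul_one, Complex.norm_real,
    Real.norm_of_nonneg (sq_nonneg _), ENNReal.ofReal_rpow_of_nonneg (sq_nonneg _) (by norm_num),
    ← Real.sqrt_eq_rpow, Real.sqrt_sq (norm_nonneg v)]

theorem ofReal_norm_le_hSpace (hΦ : IsSNFunction Φ) (hΨ : IsSNFunction Ψ) (v : H) :
    ENNReal.ofReal ‖v‖ ≤ hSpace H Φ Ψ 1 (Matrix.of fun _ _ => v) := by
  have h := (ofReal_norm_apply_le_mNorm hΨ _ 0 0).trans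
    (mNorm_gRho_le hΦ hΨ (Matrix.of fun _ _ : Fin 1 => v) 1)
  rw [mNorm_one_unique hΦ, mul_one, gRho_const, Complex.norm_real,
    Real.norm_of_nonneg (sq_nonneg _)] at h
  rw [hSpace_eq]
  refine le_trans (le_of_eq ?_) (ENNReal.rpow_le_rpow h (by norm_num : (0 : ℝ) ≤ 1 / 2))
  rw [ENNReal.ofReal_rpow_of_nonneg (sq_nonneg _) (by norm_num), ← Real.sqrt_eq_rpow,
    Real.sqrt_sq (norm_nonneg v)]

/-- Already the level of `1 × 1` matrices forces boundedness: there the norm of `R` is that of `H`,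
and the norm of `H(Φ, Ψ)` dominates it. -/
theorem exists_clm_of_cbNorm_lt_top (hΦ : IsSNFunction Φ) (hΨ : IsSNFunction Ψ) {u : H →ₗ[ℂ] H}
    (hu : cbNorm (rowSpace H) (hSpace H Φ Ψ) u < ∞) :
    ∃ x : H →L[ℂ] H, (x : H →ₗ[ℂ] H) = u := by
  set c := cbNorm (rowSpace H) (hSpace H Φ Ψ) u with hc
  refine ⟨u.mkContinuous c.toReal fun v => ?_, rfl⟩
  by_cases hv : v = 0
  · simp [hv]
  have h1 : hSpace H Φ Ψ 1 ((Matrix.of fun _ _ => v).map u) /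
      rowSpace H 1 (Matrix.of fun _ _ => v) ≤ c :=
    le_iSup₂ (f := fun n (T : Matrix (Fin n) (Fin n) H) => hSpace H Φ Ψ n (T.map u) /
      rowSpace H n T) 1 (Matrix.of fun _ _ => v)
  rw [rowSpace_const, ENNReal.div_le_iff (by simpa using hv) ENNReal.ofReal_ne_top] at h1
  have h2 : ENNReal.ofReal ‖u v‖ ≤ c * ENNReal.ofReal ‖v‖ :=
    (ofReal_norm_le_hSpace hΦ hΨ (u v)).trans h1
  have h3 := ENNReal.toReal_mono (ENNReal.mul_ne_top hu.ne ENNReal.ofReal_ne_top) h2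
  rwa [ENNReal.toReal_mul, ENNReal.toReal_ofReal (norm_nonneg _),
    ENNReal.toReal_ofReal (norm_nonneg _)] at h3

variable [CompleteSpace H] {b : ℕ → H}

theorem cbNorm_rowSpace (hΦ : IsSNFunction Φ) (hΨ : IsSNFunction Ψ) (hb : Orthonormal ℂ b)
    (hd : (Submodule.span ℂ (Set.range b))ᗮ = ⊥) (x : H →L[ℂ] H) :
    cbNorm (rowSpace H) (hSpace H Φ Ψ) (x : H →ₗ[ℂ] H) =
      tensSup Φ Ψ (star x * x) ^ (1 / 2 : ℝ) := by
  refine le_antisymm (iSup₂_le fun n T => ENNReal.div_le_of_le_mul ?_) ?_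
  · rw [rowSpace_eq, hSpace_eq, ← ENNReal.mul_rpow_of_nonneg _ _ (by norm_num)]
    exact ENNReal.rpow_le_rpow (hSq_map_le hΦ hΨ hb x T) (by norm_num)
  · set c := cbNorm (rowSpace H) (hSpace H Φ Ψ) (x : H →ₗ[ℂ] H) with hc
    rw [one_div, ENNReal.rpow_inv_le_iff (by norm_num)]
    refine tensSup_le fun a _ => idealNorm_tensorOp_le hΨ hb hd fun m => ?_
    refine (mNorm_tMat_le_hSq hΦ hΨ hb m x a).trans (mul_le_mul' ?_ le_rfl)
    let e := (Fintype.equivFin (Fin (m + 1) × Fin (m + 1))).symm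
    -- Orthonormality gives `ρ_T(1) = 1`, so `T` lies in the unit ball of `R`. The equivalence `e`
    -- only relabels the pairs of indices by `Fin`.
    let T := ampl (colT fun i : Fin (m + 1) => b i) (Fin (m + 1))
    have h1 : gRho T 1 = 1 := by
      ext p q
      rw [gRho_ampl_colT, orthonormal_iff_ite.1 (orthonormal_fin hb (m + 1)), Matrix.one_apply,
        Matrix.one_apply]
      by_cases h1 : p.1 = q.1 <;> by_cases h2 : p.2 = q.2 <;> simp [h1, h2, Prod.ext_iff, eq_comm]
    have h2 : rowSpace H _ (T.submatrix e e) ≤ 1 := by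
      have : (1 : Matrix (Fin (Fintype.card (Fin (m + 1) × Fin (m + 1)))) _ ℂ) =
          (1 : Matrix _ _ ℂ).submatrix e e := by simp
      rw [rowSpace_eq, this, gRho_submatrix, h1, ← this, map_one]
      refine ENNReal.rpow_le_one ?_ (by norm_num)
      rw [ENNReal.ofReal_le_one]
      exact norm_id_le
    have h3 : hSpace H Φ Ψ _ ((T.submatrix e e).map (x : H →ₗ[ℂ] H)) /
        rowSpace H _ (T.submatrix e e) ≤ c :=
      le_iSup₂ (f := fun n (T : Matrix (Fin n) (Fin n) H) => hSpace H Φ Ψ n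
        (T.map (x : H →ₗ[ℂ] H)) / rowSpace H n T) _ (T.submatrix e e)
    have h4 : hSpace H Φ Ψ _ ((T.map (x : H →ₗ[ℂ] H)).submatrix e e) ≤ c :=
      calc _ = hSpace H Φ Ψ _ ((T.submatrix e e).map (x : H →ₗ[ℂ] H)) / 1 := (div_one _).symm
        _ ≤ _ := ENNReal.div_le_div le_rfl h2
        _ ≤ c := h3
    rw [hSpace_eq, hSq_submatrix_equiv hΦ hΨ, ampl_colT_map, one_div,
      ENNReal.rpow_inv_le_iff (by norm_num)] at h4
    exact h4

/-! ### Evaluation of the tensor supremum -/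

/-- The projection onto the first basis vector. -/
theorem exists_rankOne (hΦ : IsSNFunction Φ) (hb : Orthonormal ℂ b) :
    ∃ z : H →L[ℂ] H, (∀ v, z v = (inner ℂ (b 0) v : ℂ) • b 0) ∧ z ∈ symmIdeal (E := H) Φ ∧ z ≠ 0 ∧
      idealNorm Φ z = 1 := by
  have hb1 := orthonormal_fin hb 1
  let z := ofMat (fun i : Fin 1 => b i) (1 : Matrix (Fin 1) (Fin 1) ℂ)
  have hz0 : z ≠ 0 := ofMat_ne_zero hb1 one_ne_zero
  have hz : ∀ v, z v = (inner ℂ (b 0) v : ℂ) • b 0 := by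
    intro v
    have : z v = synth (fun i : Fin 1 => b i) (adjoint (synth (fun i : Fin 1 => b i)) v) := by
      simp only [z, ofMat, map_one]
      rfl
    rw [this, synth_apply]
    simp [adjoint_synth_apply]
  refine ⟨z, hz, ofMat_mem_symmIdeal hb1 hΦ 1, hz0, le_antisymm ?_ ?_⟩
  · exact (idealNorm_ofMat_le hb1 hΦ 1).trans_eq (mNorm_one_unique hΦ)
  · refine le_trans ?_ (ofReal_norm_le_idealNorm hΦ z)
    rw [ENNReal.one_le_ofReal]
    have h1 := z.le_opNorm (b 0)
    rw [hz, inner_self_eq_norm_sq_to_K, hb.norm_eq_one] at h1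
    simpa [hb.norm_eq_one] using h1

/-- Testing with the rank-one projection `z` onto `b 0` suffices: `x` is the compression of `x ⊗ z`
by the isometry `v ↦ v ⊗ b 0`. -/
theorem idealNorm_le_tensSup (hΦ : IsSNFunction Φ) (hΨ : IsSNFunction Ψ) (hb : Orthonormal ℂ b)
    (x : H →L[ℂ] H) : idealNorm Ψ x ≤ tensSup Φ Ψ x := by
  obtain ⟨z, hz, hzm, hz0, hz1⟩ := exists_rankOne hΦ hb
  have h := idealNorm_tensorOp_le_tensSup (Ψ := Ψ) hΦ x hzm hz0
  rw [hz1, mul_one] at h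
  refine le_trans ?_ h
  have hx : x = adjoint (tensRight (b 0)) ∘L tensorOp x z ∘L tensRight (b 0) := by
    ext v
    refine ext_inner_left ℂ fun w => ?_
    rw [comp_apply, comp_apply, adjoint_inner_right, tensRight_apply, tensRight_apply,
      tensorOp_tens, inner_tens, hz, inner_self_eq_norm_sq_to_K, hb.norm_eq_one]
    simp [inner_self_eq_norm_sq_to_K, hb.norm_eq_one]
  have hn : ‖tensRight (b 0)‖ ≤ 1 := (norm_tensRight_le _).trans_eq (hb.norm_eq_one 0)
  conv_lhs => rw [hx]
  refine idealNorm_comp_le_of_norm_le_one hΨ _ ?_ hn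
  rwa [LinearIsometryEquiv.norm_map]

theorem idealNorm_tensorOp_rankOne_le (hΦ : IsSNFunction Φ) (hb : Orthonormal ℂ b)
    {z : H →L[ℂ] H} (hz : ∀ v, z v = (inner ℂ (b 0) v : ℂ) • b 0) (a : H →L[ℂ] H) :
    idealNorm Φ (tensorOp z a) ≤ idealNorm Φ a := by
  have hn : ‖tensLeft (b 0)‖ ≤ 1 := (norm_tensLeft_le _).trans_eq (hb.norm_eq_one 0)
  have ha : ∀ v w, adjoint (tensLeft (b 0)) (tens v w) = (inner ℂ (b 0) v : ℂ) • w := by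
    intro v w
    refine ext_inner_left ℂ fun u => ?_
    rw [adjoint_inner_right, tensLeft_apply, inner_tens, inner_smul_right]
  have h : tensorOp z a = tensLeft (b 0) ∘L a ∘L adjoint (tensLeft (b 0)) := by
    refine clm_ext_tens fun v w => ?_
    rw [tensorOp_tens, comp_apply, comp_apply, ha, map_smul, map_smul, tensLeft_apply, hz]
    exact (tensRight (a w)).map_smul _ _
  rw [h]
  refine idealNorm_comp_le_of_norm_le_one hΦ _ hn ?_
  rwa [LinearIsometryEquiv.norm_map]

/-- With the rank-one projection for `z`, the right side of the cross inequality is at most `‖a‖_Φ`,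
since `z ⊗ a` is a copy of `a` padded by zero. -/
theorem CrossInequality.tensSup_le (hΦ : IsSNFunction Φ) (hΨ : IsSNFunction Ψ)
    (hle : ∀ ξ, Ψ ξ ≤ Φ ξ) (hb : Orthonormal ℂ b)
    (hd : (Submodule.span ℂ (Set.range b))ᗮ = ⊥) (h : CrossInequality H Φ Ψ) (x : H →L[ℂ] H) :
    tensSup Φ Ψ x ≤ idealNorm Ψ x := by
  refine NormedIdeals.tensSup_le fun a ha => idealNorm_tensorOp_le hΨ hb hd fun m => ?_
  have hbm := orthonormal_fin hb (m + 1)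
  -- The cross inequality only concerns elements of `𝔖_Φ`, to which `x` need not belong. Its finite
  -- rank compression `y` does, and has the same compressed tensor product with `a`.
  let y := ofMat (fun i : Fin (m + 1) => b i) (cMat b m x)
  have hy : y ∈ symmIdeal (E := H) Φ := ofMat_mem_symmIdeal hbm hΦ _
  have h1 : tMat b m x a = tMat b m y a := by
    ext p q
    simp only [tMat, Matrix.of_apply]
    rw [inner_ofMat hbm]
    rfl
  by_cases hy0 : y = 0
  · have : tMat b m x a = 0 := by
      rw [h1, hy0]
      ext p q
      simp [tMat]
    rw [this, mNorm_zero hΨ]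
    simp
  obtain ⟨z, hz, hzm, hz0, hz1⟩ := exists_rankOne hΦ hb
  have h2 := (h y hy a ha z hzm hy0 hz0).trans
    (ENNReal.div_le_div (idealNorm_tensorOp_rankOne_le hΦ hb hz a) le_rfl)
  rw [hz1, div_one, ENNReal.div_le_iff (idealNorm_ne_zero hΨ hy0)
    ((idealNorm_mono_fn hle y).trans_lt hy.2).ne, mul_comm] at h2
  rw [h1]
  refine (mNorm_tMat_le hΨ hb m y a).trans (h2.trans (mul_le_mul' ?_ le_rfl))
  exact (idealNorm_ofMat_le hbm hΨ _).trans (mNorm_cMat_le hΨ hb m x)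

/-- The block axiom reduces the repeated columns testing `|x|² ⊗ a` to one column, whose norm no
longer involves `a`. -/
theorem BlockMax.tensSup_le (hΦ : IsSNFunction Φ) (hΨ : IsSNFunction Ψ) (hb : Orthonormal ℂ b)
    (hd : (Submodule.span ℂ (Set.range b))ᗮ = ⊥) (h : BlockMax H Φ Ψ) (x : H →L[ℂ] H) :
    tensSup Φ Ψ (star x * x) ≤ idealNorm Ψ (star x * x) := by
  refine NormedIdeals.tensSup_le fun a _ => idealNorm_tensorOp_le hΨ hb hd fun m => ?_
  refine (mNorm_tMat_le_hSq hΦ hΨ hb m x a).trans (mul_le_mul' ?_ le_rfl)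
  exact (h.ampl_le hΦ hΨ _ _).trans (hSq_colT_le hΦ hΨ hb m x)

theorem cbIdentification_rowSpace (hΦ : IsSNFunction Φ) (hΨ : IsSNFunction Ψ)
    (hb : Orthonormal ℂ b) (hd : (Submodule.span ℂ (Set.range b))ᗮ = ⊥)
    (h : ∀ x : H →L[ℂ] H, tensSup Φ Ψ (star x * x) ≤ idealNorm Ψ (star x * x)) :
    CBIdentification (rowSpace H) (hSpace H Φ Ψ) (twoConvex Ψ) := by
  have hcb : ∀ x : H →L[ℂ] H, cbNorm (rowSpace H) (hSpace H Φ Ψ) (x : H →ₗ[ℂ] H) =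
      idealNorm (twoConvex Ψ) x := fun x => by
    rw [cbNorm_rowSpace hΦ hΨ hb hd, idealNorm_twoConvex hΨ,
      le_antisymm (h x) (idealNorm_le_tensSup hΦ hΨ hb _)]
  have hset : CB (rowSpace H) (hSpace H Φ Ψ) =
      (fun x : H →L[ℂ] H => (x : H →ₗ[ℂ] H)) '' boundedIdeal (twoConvex Ψ) := by
    ext u
    constructor
    · intro hu
      obtain ⟨x, rfl⟩ := exists_clm_of_cbNorm_lt_top hΦ hΨ hu
      exact ⟨x, (hcb x).symm.trans_lt hu, rfl⟩
    · rintro ⟨x, hx, rfl⟩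
      exact (hcb x).trans_lt hx
  refine ⟨⟨hset, fun x _ => hcb x⟩, fun hs => ⟨?_, fun x _ => hcb x⟩⟩
  have : symmIdeal (E := H) (twoConvex Ψ) = boundedIdeal (twoConvex Ψ) :=
    Set.Subset.antisymm (fun x hx => hx.2)
      fun x hx => ⟨isCompactOperator_of_idealNorm_twoConvex hΨ hs hx, hx⟩
  rw [this, hset]

/-! ### Reduction of the column space to the row space -/

omit [CompleteSpace H] in
theorem colSpace_eq {n : ℕ} (T : Matrix (Fin n) (Fin n) H) :
    colSpace H n T = rowSpace H n T.transpose := by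
  have h : colGram T = (rho T.transpose 1).transpose := by
    ext j k
    simp [colGram, rho, Matrix.one_apply]
  have h2 := norm_toEuclideanCLM_transpose (rho T.transpose 1)
  rw [← h] at h2
  rw [colSpace, rowSpace]
  exact congrArg (fun r => ENNReal.ofReal (Real.sqrt r)) h2

-- Transposition permutes the matrices over which the supremum is taken, commutes with applying `u`
-- entrywise, and carries both matrix norms to those of the row problem for the adjoint pair.
omit [CompleteSpace H] in
theorem cbNorm_colSpace (hΦ : IsSNFunction Φ) (hΨ : IsSNFunction Ψ) (u : H →ₗ[ℂ] H) :
    cbNorm (colSpace H) (hSpace H Φ Ψ) u =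
      cbNorm (rowSpace H) (hSpace H (adjointFn Ψ) (adjointFn Φ)) u := by
  refine iSup_congr fun n => ?_
  refine Function.Surjective.iSup_congr Matrix.transpose
    (fun T => ⟨T.transpose, Matrix.transpose_transpose T⟩) fun T => ?_
  rw [colSpace_eq, hSpace_eq, hSpace_eq,
    show T.transpose.map u = (T.map u).transpose from rfl, hSq_transpose hΦ hΨ]

omit [CompleteSpace H] in
theorem CBIdentification.congr {E F E' F' : MatrixNorms H} {Θ : (ℕ →₀ ℝ) → ℝ}
    (h : ∀ u, cbNorm E F u = cbNorm E' F' u) (hE : CBIdentification E' F' Θ) :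
    CBIdentification E F Θ := by
  simpa only [CBIdentification, CBIsometricEq, CB, h] using hE

end Final

end

end NormedIdeals

end

theorem mainTheorem5 {H : Type*} [NormedAddCommGroup H] [InnerProductSpace ℂ H] [CompleteSpace H]
    [TopologicalSpace.SeparableSpace H] (hH : ¬ FiniteDimensional ℂ H)
    (Φ Ψ : (ℕ →₀ ℝ) → ℝ) (hΦ : NormedIdeals.IsSNFunction Φ) (hΨ : NormedIdeals.IsSNFunction Ψ)
    (hle : ∀ ξ, Ψ ξ ≤ Φ ξ) :
    (∀ x : H →L[ℂ] H,
      NormedIdeals.cbNorm (NormedIdeals.rowSpace H) (NormedIdeals.hSpace H Φ Ψ)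
          (x : H →ₗ[ℂ] H) =
        (⨆ a ∈ {a ∈ NormedIdeals.symmIdeal (E := H) Φ | a ≠ 0},
          NormedIdeals.idealNorm Ψ (NormedIdeals.tensorOp (star x * x) a) /
            NormedIdeals.idealNorm Φ a) ^ (1 / 2 : ℝ)) ∧
    (NormedIdeals.CrossInequality H Φ Ψ →
      NormedIdeals.CBIdentification (NormedIdeals.rowSpace H) (NormedIdeals.hSpace H Φ Ψ)
        (NormedIdeals.twoConvex Ψ)) ∧
    (NormedIdeals.CrossInequality H (NormedIdeals.adjointFn Ψ) (NormedIdeals.adjointFn Φ) →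
      NormedIdeals.CBIdentification (NormedIdeals.colSpace H) (NormedIdeals.hSpace H Φ Ψ)
        (NormedIdeals.twoConvex (NormedIdeals.adjointFn Φ))) ∧
    (NormedIdeals.IsOperatorSpace (NormedIdeals.hSpace H Φ Ψ) →
      NormedIdeals.CBIdentification (NormedIdeals.rowSpace H) (NormedIdeals.hSpace H Φ Ψ)
          (NormedIdeals.twoConvex Ψ) ∧
        NormedIdeals.CBIdentification (NormedIdeals.colSpace H) (NormedIdeals.hSpace H Φ Ψ)
          (NormedIdeals.twoConvex (NormedIdeals.adjointFn Φ))) := by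
  obtain ⟨b, hb, hd⟩ := NormedIdeals.exists_orthonormal_seq hH
  have hΦ' := NormedIdeals.isSNFunction_adjointFn hΦ
  have hΨ' := NormedIdeals.isSNFunction_adjointFn hΨ
  refine ⟨fun x => NormedIdeals.cbNorm_rowSpace hΦ hΨ hb hd x, fun h => ?_, fun h => ?_,
    fun h => ⟨?_, ?_⟩⟩
  · exact NormedIdeals.cbIdentification_rowSpace hΦ hΨ hb hd
      fun x => h.tensSup_le hΦ hΨ hle hb hd _
  -- Passing to adjoints reverses the order of `Φ` and `Ψ`, so `(Ψ*, Φ*)` is again an admissible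
  -- pair for the row case.
  · exact NormedIdeals.CBIdentification.congr (NormedIdeals.cbNorm_colSpace hΦ hΨ)
      (NormedIdeals.cbIdentification_rowSpace hΨ' hΦ' hb hd fun x => h.tensSup_le hΨ' hΦ'
        (NormedIdeals.adjointFn_antitone hΦ hΨ hle) hb hd _)
  · exact NormedIdeals.cbIdentification_rowSpace hΦ hΨ hb hd
      fun x => h.blockMax.tensSup_le hΦ hΨ hb hd x
  · exact NormedIdeals.CBIdentification.congr (NormedIdeals.cbNorm_colSpace hΦ hΨ)
      (NormedIdeals.cbIdentification_rowSpace hΨ' hΦ' hb hd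
        fun x => (h.blockMax.adjoint hΦ hΨ).tensSup_le hΨ' hΦ' hb hd x)
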